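/- Let $n\in\mathbb N$ and $\alpha>0$. Then there exists a Borel function $w\colon\mathbb R^n\to[0,\infty)$ such that the measure $\mu:=w\,\mathcal L^n$ is doubling (balls have finite positive measure and $\mu(B(x,2r))\le C\mu(B(x,r))$ for all $x\in\mathbb R^n$, $r>0$, with a constant $C$) and the following two statements hold. (1) For every $p$ with $1\le p\le 1+\alpha$, the family $\Gamma_c$ of all non-constant absolutely continuous curves in $\mathbb R^n$ satisfies $\mathrm{Mod}_{p,\mu}(\Gamma_c)=0$, and for every function $f\colon\mathbb R^n\to\mathbb R$ the $p$-weak gradient of $f$ on $(\mathbb R^n,|\cdot|,\mu)$ is zero $\mu$-almost everywhere. (2) For every $p>1+\alpha$, the function $w$ is a Muckenhoupt $A_p$-weight, that is, $w$ and $w^{1/(1-p)}$ are integrable on balls and, for some constant $C$ and all balls $B$, $\left(\frac1{|B|}\int_B w\right)\left(\frac1{|B|}\int_B w^{1/(1-p)}\right)^{p-1}\le C$. Moreover $\mu$ supports a weak $p$-Poincaré inequality: there are constants $C>0$ and $\lambda\ge1$ such that, with averages taken with respect to $\mu$, $$\frac1{\mu(B)}\int_B|f-f_B|\,d\mu\le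 Cr\left(\frac1{\mu(\lambda B)}\int_{\lambda B}|\nabla f|^p\,d\mu\right)^{1/p}$$ for every ball $B$ of radius $r$ and every $f$ that is locally Lipschitz on $\lambda B$. Finally, for every Lipschitz function $f\colon\mathbb R^n\to\mathbb R$ the $p$-weak gradient of $f$ on $(\mathbb R^n,|\cdot|,\mu)$ equals the slope $|\nabla f|$ $\mu$-almost everywhere. Here a curve is a continuous map $\gamma\colon[a,b]\to\mathbb R^n$. It is absolutely continuous if there is an integrable $g$ with $|\gamma(s)-\gamma(t)|\le\int_s^t g$ for all $s<t$ in $[a,b]$; the smallest such $g$ is the metric speed $|\dot\gamma|$, and $\int_\gamma g=\int_a^b g(\gamma(s))\,|\dot\gamma|(s)\,ds$. The $p$-modulus is $\mathrm{Mod}_{p,\mu}(\Gamma)=\inf\int g^p\,d\mu$ over all Borel $g\colon\mathbb R^n\to[0,\infty]$ with $\int_\gamma g\ge1$ for all $\gamma\in\Gamma$. A Borel function $g\colon\mathbb R^n\to[0,\infty]$ is a $p$-upper gradient of $f$ if $|f(\gamma(b))-f(\gamma(a))|\le\int_\gamma g$ for all absolutely continuous curves $\gamma$ outside a family of $p$-modulus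 zero. The $p$-weak gradient of $f$ is the locally $p$-integrable (with respect to $\mu$) $p$-upper gradient that is $\mu$-a.e. at most every other locally $p$-integrable $p$-upper gradient of $f$. The slope is $|\nabla f|(x)=\limsup_{y\to x}|f(y)-f(x)|/|y-x|$. -/

import Mathlib

open MeasureTheory Set Filter Topology
open scoped ENNReal NNReal

noncomputable section

/-- An absolutely continuous curve in a metric space: a map on a compact interval `[a, b]` for
which some Lebesgue integrable `g` satisfies `d(γ(s), γ(t)) ≤ ∫_s^t g` whenever `s ≤ t` in `[a, b]`.
The values of `toFun` outside `[a, b]` play no role. -/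
structure ACCurve (X : Type*) [MetricSpace X] where
  a : ℝ
  b : ℝ
  a_le_b : a ≤ b
  toFun : ℝ → X
  absCont : ∃ g : ℝ → ℝ, IntegrableOn g (Icc a b) volume ∧
    ∀ s ∈ Icc a b, ∀ t ∈ Icc a b, s ≤ t → dist (toFun s) (toFun t) ≤ ∫ r in s..t, g r

namespace ACCurve

variable {X : Type*} [MetricSpace X]

/-- The curve is not constant. -/
def NonConstant (γ : ACCurve X) : Prop :=
  ∃ s ∈ Icc γ.a γ.b, ∃ t ∈ Icc γ.a γ.b, γ.toFun s ≠ γ.toFun t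

/-- The metric speed `|γ̇|(t) = limsup_{s → t, s ∈ [a, b]} d(γ(s), γ(t)) / |s - t|`.
By `edist_le_lintegral_metricSpeed` and `metricSpeed_le` below, it is, up to Lebesgue null sets,
the smallest function that bounds the distances along the curve by its integrals. -/
def metricSpeed (γ : ACCurve X) (t : ℝ) : ℝ≥0∞ :=
  limsup (fun s => edist (γ.toFun s) (γ.toFun t) / edist s t) (𝓝[Icc γ.a γ.b \ {t}] t)

/-- The integral `∫_γ g = ∫_a^b g(γ(s)) |γ̇|(s) ds` of a function `g` with values in `[0, ∞]`. -/
def lineIntegral (γ : ACCurve X) (g : X → ℝ≥0∞) : ℝ≥0∞ :=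
  ∫⁻ s in Icc γ.a γ.b, g (γ.toFun s) * γ.metricSpeed s

theorem edist_le_lintegral_metricSpeed (γ : ACCurve X) {s t : ℝ} (hs : s ∈ Icc γ.a γ.b)
    (ht : t ∈ Icc γ.a γ.b) (hst : s ≤ t) :
    edist (γ.toFun s) (γ.toFun t) ≤ ∫⁻ r in Icc s t, γ.metricSpeed r := by
  obtain ⟨g, hg, hd⟩ := γ.absCont
  have hsub : Icc s t ⊆ Icc γ.a γ.b := Icc_subset_Icc hs.1 ht.2
  have hint : IntervalIntegrable g volume s t :=
    (intervalIntegrable_iff_integrableOn_Icc_of_le hst).2 (hg.mono_set hsub)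
  set φ : ℝ → ℝ := fun r => dist (γ.toFun s) (γ.toFun r) with hφ
  have hG := hint.absolutelyContinuousOnInterval_intervalIntegral (c := s) left_mem_uIcc
  have key : ∀ x ∈ Icc s t, ∀ y ∈ Icc s t, x ≤ y →
      dist (φ x) (φ y) ≤ dist (∫ v in s..x, g v) (∫ v in s..y, g v) := by
    intro x hx y hy hxy
    have h1 : dist (φ x) (φ y) ≤ dist (γ.toFun x) (γ.toFun y) := by
      rw [Real.dist_eq]
      simp only [hφ, dist_comm (γ.toFun s)]
      exact abs_dist_sub_le _ _ _
    have h2 := hd x (hsub hx) y (hsub hy) hxy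
    have ix : IntervalIntegrable g volume s x := hint.mono_set (by
      rw [uIcc_of_le hx.1, uIcc_of_le hst]; exact Icc_subset_Icc le_rfl hx.2)
    have iy : IntervalIntegrable g volume s y := hint.mono_set (by
      rw [uIcc_of_le hy.1, uIcc_of_le hst]; exact Icc_subset_Icc le_rfl hy.2)
    have h3 := intervalIntegral.integral_interval_sub_left iy ix
    rw [dist_comm (∫ v in s..x, g v), Real.dist_eq (∫ v in s..y, g v), h3]
    exact (h1.trans h2).trans (le_abs_self _)
  have hAC : AbsolutelyContinuousOnInterval φ s t := by
    refine squeeze_zero' (Eventually.of_forall fun E => Finset.sum_nonneg fun i _ => dist_nonneg)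
      ?_ hG
    refine eventually_inf_principal.2 (Eventually.of_forall fun E hE => ?_)
    refine Finset.sum_le_sum fun i hi => ?_
    obtain ⟨h1, h2⟩ := hE.1 i hi
    rw [uIcc_of_le hst] at h1 h2
    rcases le_total (E.2 i).1 (E.2 i).2 with h | h
    · exact key _ h1 _ h2 h
    · rw [dist_comm, dist_comm (∫ v in s..(E.2 i).1, g v)]
      exact key _ h2 _ h1 h
  have hval : ∫ r in s..t, deriv φ r = dist (γ.toFun s) (γ.toFun t) := by
    rw [hAC.integral_deriv_eq_sub]; simp [hφ]
  have hpt : ∀ r ∈ Ioo s t, ‖deriv φ r‖ₑ ≤ γ.metricSpeed r := by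
    intro r hr
    by_cases hdiff : DifferentiableAt ℝ φ r
    swap
    · simp [deriv_zero_of_not_differentiableAt hdiff]
    have hmem : Icc γ.a γ.b ∈ 𝓝 r :=
      mem_of_superset (Icc_mem_nhds hr.1 hr.2) hsub
    have hfil : 𝓝[Icc γ.a γ.b \ {r}] r = 𝓝[≠] r := by
      rw [Set.sdiff_eq, inter_comm]
      exact nhdsWithin_inter_of_mem' (mem_nhdsWithin_of_mem_nhds hmem)
    have hlim : Tendsto (fun y => ‖slope φ r y‖ₑ) (𝓝[≠] r) (𝓝 ‖deriv φ r‖ₑ) :=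
      (continuous_enorm.tendsto _).comp (hasDerivAt_iff_tendsto_slope.1 hdiff.hasDerivAt)
    rw [metricSpeed, hfil, ← hlim.limsup_eq]
    refine limsup_le_limsup ?_
    filter_upwards [self_mem_nhdsWithin] with y hy
    have hy' : y - r ≠ 0 := sub_ne_zero.2 hy
    rw [slope_def_field, div_eq_mul_inv, enorm_mul, enorm_inv hy', ← div_eq_mul_inv,
      ← edist_eq_enorm_sub, ← edist_eq_enorm_sub]
    gcongr
    simp only [hφ, edist_dist]
    gcongr
    rw [Real.dist_eq]
    simp only [dist_comm (γ.toFun s)]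
    exact abs_dist_sub_le _ _ _
  calc edist (γ.toFun s) (γ.toFun t) = ‖∫ r in s..t, deriv φ r‖ₑ := by
        rw [hval, edist_dist, Real.enorm_of_nonneg dist_nonneg]
    _ ≤ ∫⁻ r in Ioc s t, ‖deriv φ r‖ₑ := by
        rw [intervalIntegral.integral_of_le hst]; exact enorm_integral_le_lintegral_enorm _
    _ = ∫⁻ r in Ioo s t, ‖deriv φ r‖ₑ := by
        rw [Measure.restrict_congr_set Ioo_ae_eq_Ioc.symm]
    _ ≤ ∫⁻ r in Ioo s t, γ.metricSpeed r := setLIntegral_mono' measurableSet_Ioo hpt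
    _ ≤ ∫⁻ r in Icc s t, γ.metricSpeed r := lintegral_mono_set Ioo_subset_Icc_self

theorem metricSpeed_le (γ : ACCurve X) {g : ℝ → ℝ} (hg : IntegrableOn g (Icc γ.a γ.b) volume)
    (hd : ∀ s ∈ Icc γ.a γ.b, ∀ t ∈ Icc γ.a γ.b, s ≤ t →
      dist (γ.toFun s) (γ.toFun t) ≤ ∫ r in s..t, g r) :
    ∀ᵐ t, t ∈ Icc γ.a γ.b → γ.metricSpeed t ≤ ENNReal.ofReal (g t) := by
  have hab := γ.a_le_b
  have hint : IntervalIntegrable g volume γ.a γ.b :=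
    (intervalIntegrable_iff_integrableOn_Icc_of_le hab).2 hg
  filter_upwards [hint.ae_hasDerivAt_integral] with t ht htI
  rw [uIcc_of_le hab] at ht
  have hder := ht htI γ.a ⟨le_rfl, hab⟩
  have hlim := (ENNReal.continuous_ofReal.tendsto _).comp
    ((hasDerivAt_iff_tendsto_slope.1 hder).mono_left
      (nhdsWithin_mono t (fun y hy => hy.2 : Icc γ.a γ.b \ {t} ⊆ {t}ᶜ)))
  rw [metricSpeed]
  rcases eq_or_neBot (𝓝[Icc γ.a γ.b \ {t}] t) with hbot | hne
  · simp [hbot]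
  rw [← hlim.limsup_eq]
  refine limsup_le_limsup ?_
  filter_upwards [self_mem_nhdsWithin] with y hy
  have hi : ∀ x ∈ Icc γ.a γ.b, IntervalIntegrable g volume γ.a x := fun x hx =>
    hint.mono_set (by rw [uIcc_of_le hx.1, uIcc_of_le hab]; exact Icc_subset_Icc le_rfl hx.2)
  have hyt : y ≠ t := hy.2
  have hsl : dist (γ.toFun y) (γ.toFun t) / dist y t
      ≤ slope (fun x => ∫ v in γ.a..x, g v) t y := by
    rw [slope_def_field, Real.dist_eq]
    rcases lt_or_gt_of_ne hyt with h | h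
    · have := hd y hy.1 t htI h.le
      rw [← intervalIntegral.integral_interval_sub_left (hi t htI) (hi y hy.1)] at this
      rw [abs_of_neg (sub_neg.2 h), ← neg_div_neg_eq (_ - _) (y - t), neg_sub (∫ v in γ.a..y, g v)]
      gcongr
      linarith
    · have := hd t htI y hy.1 h.le
      rw [← intervalIntegral.integral_interval_sub_left (hi y hy.1) (hi t htI), dist_comm] at this
      rw [abs_of_pos (sub_pos.2 h)]
      gcongr
  simp only [Function.comp]
  rw [edist_dist, edist_dist, ← ENNReal.ofReal_div_of_pos (dist_pos.2 hyt)]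
  exact ENNReal.ofReal_le_ofReal hsl

end ACCurve

section MetricMeasure

variable {X : Type*} [MetricSpace X] [MeasurableSpace X]

/-- The `p`-modulus of a family of absolutely continuous curves. -/
def pModulus (m : Measure X) (p : ℝ) (Γ : Set (ACCurve X)) : ℝ≥0∞ :=
  ⨅ (g : X → ℝ≥0∞) (_ : Measurable g) (_ : ∀ γ ∈ Γ, 1 ≤ γ.lineIntegral g), ∫⁻ x, g x ^ p ∂m

/-- `g` is a `p`-upper gradient of `f`: the family of the absolutely continuous curves `γ` along
which `|f(γ(b)) - f(γ(a))| ≤ ∫_γ g` fails has `p`-modulus zero. -/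
def IsPUpperGradient (m : Measure X) (p : ℝ) (f : X → ℝ) (g : X → ℝ≥0∞) : Prop :=
  Measurable g ∧
    pModulus m p {γ | ¬ edist (f (γ.toFun γ.b)) (f (γ.toFun γ.a)) ≤ γ.lineIntegral g} = 0

/-- `g` is locally `p`-integrable. -/
def IsLocallyPIntegrable (m : Measure X) (p : ℝ) (g : X → ℝ≥0∞) : Prop :=
  ∀ x, ∃ U ∈ 𝓝 x, ∫⁻ y in U, g y ^ p ∂m < ∞

/-- `g` is (a version of) the `p`-weak gradient of `f`, that is, the smallest `p`-upper gradient up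
to null sets. As usual, smallest refers to the locally `p`-integrable `p`-upper gradients; without
integrability there would be no smallest one in general (already on the line with Lebesgue measure,
the function equal to `0` on a closed nowhere dense set of positive measure and to `∞` off it
is a `p`-upper gradient of every function). -/
def IsPWeakGradient (m : Measure X) (p : ℝ) (f : X → ℝ) (g : X → ℝ≥0∞) : Prop :=
  IsPUpperGradient m p f g ∧ IsLocallyPIntegrable m p g ∧
    ∀ h : X → ℝ≥0∞, IsPUpperGradient m p f h → IsLocallyPIntegrable m p h → g ≤ᵐ[m] h

/-- The `p`-weak gradient is unique up to null sets. -/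
theorem IsPWeakGradient.ae_eq {m : Measure X} {p : ℝ} {f : X → ℝ} {g h : X → ℝ≥0∞}
    (hg : IsPWeakGradient m p f g) (hh : IsPWeakGradient m p f h) : g =ᵐ[m] h :=
  (hg.2.2 h hh.1 hh.2.1).antisymm (hh.2.2 g hg.1 hg.2.1)

/-- The slope `|∇f|(x) = limsup_{y → x, y ≠ x} |f(y) - f(x)| / d(y, x)`. -/
def localSlope (f : X → ℝ) (x : X) : ℝ≥0∞ :=
  limsup (fun y => edist (f y) (f x) / edist y x) (𝓝[≠] x)

/-- Balls have finite positive measure, and the measure is doubling on all balls. -/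
def IsDoublingMeasure (m : Measure X) : Prop :=
  (∀ x : X, ∀ r : ℝ, 0 < r → 0 < m (Metric.ball x r) ∧ m (Metric.ball x r) < ∞) ∧
    ∃ C : ℝ≥0, 1 ≤ C ∧ ∀ x : X, ∀ r : ℝ, 0 < r →
      m (Metric.ball x (2 * r)) ≤ C * m (Metric.ball x r)

/-- The weak `p`-Poincaré inequality
`⨍_B |f - f_B| dm ≤ C r (⨍_{λB} |∇f| ^ p dm) ^ (1 / p)` for balls `B` of radius `r` and functions
`f` that are locally Lipschitz on `λB`. The left side is an integral with values in `[0, ∞]`, so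
it is `∞` (and not a junk value) if `f` is not integrable on `B`. -/
def WeakPoincare (m : Measure X) (p : ℝ) : Prop :=
  ∃ C : ℝ≥0, ∃ l : ℝ, 1 ≤ l ∧ ∀ (x : X) (r : ℝ), 0 < r → ∀ f : X → ℝ,
    LocallyLipschitzOn (Metric.ball x (l * r)) f →
      ⨍⁻ y in Metric.ball x r, edist (f y) (⨍ z in Metric.ball x r, f z ∂m) ∂m ≤
        C * ENNReal.ofReal r *
          (⨍⁻ y in Metric.ball x (l * r), localSlope f y ^ p ∂m) ^ (1 / p)

end MetricMeasure

/-- `w` is a Muckenhoupt `A_p`-weight. The finiteness of both integrals is part of the condition: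
it makes the averages well defined and excludes the product `0 * ∞`, so the zero weight and weights
vanishing on a set of positive measure do not qualify. -/
def IsMuckenhouptWeight {n : ℕ} (p : ℝ) (w : EuclideanSpace ℝ (Fin n) → ℝ≥0) : Prop :=
  Measurable w ∧ ∃ C : ℝ≥0, ∀ (x : EuclideanSpace ℝ (Fin n)) (r : ℝ), 0 < r →
    ∫⁻ y in Metric.ball x r, (w y : ℝ≥0∞) < ∞ ∧
    ∫⁻ y in Metric.ball x r, (w y : ℝ≥0∞) ^ (1 / (1 - p)) < ∞ ∧
    (⨍⁻ y in Metric.ball x r, (w y : ℝ≥0∞) ∂volume) *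
      (⨍⁻ y in Metric.ball x r, (w y : ℝ≥0∞) ^ (1 / (1 - p)) ∂volume) ^ (p - 1) ≤ C

end

/-!
The weight is `w = N ^ (-α)`, where `N = max 1 (sup_{j, i} 2^{-i} / |x_j - q_i|)` for a dense
sequence `q` of reals (`singularSup`, `singularWeight`). It vanishes like `|x_j - q_i| ^ α` along a
dense family of hyperplanes, and `1 + α` is the critical exponent for `|t| ^ α` on the line.

*Large exponents.* Let `p > 1 + α` and `s = α / (p - 1) < 1`, so that `w ^ (1 / (1 - p)) = N ^ s`.
As the singularities `|x_j - q_i| ^ (-s)` are locally integrable and the coefficients `2^{-i}`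
decrease geometrically, `N ^ s` satisfies `⨍_B N ^ s ≤ C N(z) ^ s` for all `z` in the ball `B`
(`exists_setLIntegral_singularSup_rpow_le_mul`). This strong `A₁`-estimate gives the `A_p` condition
pointwise (`exists_singularWeight_mul_rpow_le`) and, together with Hölder's inequality, the doubling
property and the bound of `w` on `B` by a constant times its average over `B`. Therefore the
`(1, 1)`-Poincaré inequality for the Lebesgue measure (`lintegral_lintegral_edist_le`) implies the
weak `p`-Poincaré inequality for `w`, without maximal functions.
The slope of a Lipschitz function is an upper gradient by the chain rule along curves. It is the
least one: a function in `L^p_loc(μ)` is locally Lebesgue integrable, so that by Fubini's theorem a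
family of curves of modulus zero contains no subsegment of almost every segment in a given direction
(`ae_segment_notMem_of_pModulus_eq_zero`); an upper gradient thus dominates each directional
derivative almost everywhere (`ae_enorm_fderiv_apply_le`), and Rademacher's theorem concludes.

*Small exponents.* Let `p = 1 + α`. A curve along which the coordinate `x_j` crosses an interval
passes to the right of some `q_i` in the interval. The logarithmic ramp of height `1` on
`[q_i + δ e^{-L}, q_i + δ]` has slope about `1 / (L t)` at `t = x_j - q_i`, and
`∫ (1 / (L t)) ^ (1 + α) t ^ α dt = L ^ (-α)` tends to `0` as `L → ∞`
(`pModulus_crossingCurves_le`). So bounded curves of this kind have modulus zero for `p = 1 + α`,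
by Hölder's inequality also for smaller `p`, and countably many such families exhaust the
non-constant curves (`pModulus_nonConstant_eq_zero`). Then `0` is an upper gradient of every
function.
-/

noncomputable section

/-! ### Slopes and upper gradients -/

namespace ACCurve

variable {X : Type*} [MetricSpace X]

theorem metricSpeed_lt_top_ae (γ : ACCurve X) :
    ∀ᵐ t, t ∈ Icc γ.a γ.b → γ.metricSpeed t < ∞ := by
  obtain ⟨g, hg, hd⟩ := γ.absCont
  filter_upwards [γ.metricSpeed_le hg hd] with t ht htI
  exact (ht htI).trans_lt ENNReal.ofReal_lt_top

theorem exists_forall_dist_le (γ : ACCurve X) :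
    ∃ M : ℝ, ∀ t ∈ Icc γ.a γ.b, dist (γ.toFun γ.a) (γ.toFun t) ≤ M := by
  obtain ⟨g, hg, hd⟩ := γ.absCont
  refine ⟨∫ r in Icc γ.a γ.b, ‖g r‖, fun t ht => ?_⟩
  refine (hd _ (left_mem_Icc.2 γ.a_le_b) t ht ht.1).trans ?_
  rw [intervalIntegral.integral_of_le ht.1]
  refine (le_abs_self _).trans (le_trans (b := ∫ r in Ioc γ.a t, ‖g r‖) ?_ ?_)
  · exact norm_integral_le_integral_norm (μ := volume.restrict (Ioc γ.a t)) g
  exact setIntegral_mono_set hg.norm (Eventually.of_forall fun _ => norm_nonneg _)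
    (Ioc_subset_Icc_self.trans (Icc_subset_Icc_right ht.2)).eventuallyLE

/-- The composition of an absolutely continuous curve with a real-valued Lipschitz function. -/
def compLipschitz (γ : ACCurve X) (f : X → ℝ) {K : ℝ≥0} (hf : LipschitzWith K f) : ACCurve ℝ where
  a := γ.a
  b := γ.b
  a_le_b := γ.a_le_b
  toFun := f ∘ γ.toFun
  absCont := by
    obtain ⟨g, hg, hd⟩ := γ.absCont
    refine ⟨fun r => K * g r, hg.const_mul _, fun s hs t ht hst => ?_⟩
    rw [intervalIntegral.integral_const_mul]
    exact (hf.dist_le_mul _ _).trans (by gcongr; exact hd s hs t ht hst)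

/-- The chain rule `|(f ∘ γ)'| ≤ |∇f|(γ) |γ'|`, at points where the speed of `γ` is finite. -/
theorem metricSpeed_compLipschitz_le (γ : ACCurve X) (f : X → ℝ) {K : ℝ≥0}
    (hf : LipschitzWith K f) {t : ℝ} (ht : γ.metricSpeed t ≠ ∞)
    (hs : localSlope f (γ.toFun t) ≠ ∞) :
    (γ.compLipschitz f hf).metricSpeed t ≤ localSlope f (γ.toFun t) * γ.metricSpeed t := by
  refine ENNReal.le_mul_of_forall_lt (Or.inr ht) (Or.inl hs) fun S hS V hV => ?_
  rcases eq_top_or_lt_top V with rfl | hVtop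
  · have : S ≠ 0 := (zero_le.trans_lt hS).ne'
    simp [ENNReal.mul_top this]
  have hspeed : ∀ᶠ s in 𝓝[Icc γ.a γ.b \ {t}] t,
      edist (γ.toFun s) (γ.toFun t) ≤ V * edist s t := by
    filter_upwards [eventually_lt_of_limsup_lt hV, self_mem_nhdsWithin] with s h1 h2
    have h3 : edist s t ≠ 0 := by simpa [edist_eq_zero] using h2.2
    exact (ENNReal.div_le_iff h3 (edist_ne_top _ _)).1 h1.le
  -- Finite speed at `t` makes `γ` continuous there, so that the bound by the slope applies.
  have hlim : Tendsto γ.toFun (𝓝[Icc γ.a γ.b \ {t}] t) (𝓝 (γ.toFun t)) := by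
    rw [tendsto_iff_edist_tendsto_0]
    refine tendsto_of_tendsto_of_tendsto_of_le_of_le' tendsto_const_nhds ?_
      (Eventually.of_forall fun _ => zero_le) hspeed
    have : Tendsto (fun s : ℝ => V * edist s t) (𝓝 t) (𝓝 (V * edist t t)) :=
      ENNReal.Tendsto.const_mul (by fun_prop : Continuous fun s : ℝ => edist s t).continuousAt
        (Or.inr hVtop.ne)
    simpa using this.mono_left nhdsWithin_le_nhds
  have hslope : ∀ᶠ y in 𝓝 (γ.toFun t), edist (f y) (f (γ.toFun t)) ≤ S * edist y (γ.toFun t) := by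
    have h0 : ∀ᶠ y in 𝓝[≠] (γ.toFun t),
        edist (f y) (f (γ.toFun t)) ≤ S * edist y (γ.toFun t) := by
      filter_upwards [eventually_lt_of_limsup_lt hS, self_mem_nhdsWithin] with y h1 h2
      have h3 : edist y (γ.toFun t) ≠ 0 := by simpa [edist_eq_zero] using h2
      exact (ENNReal.div_le_iff h3 (edist_ne_top _ _)).1 h1.le
    rw [eventually_nhdsWithin_iff] at h0
    filter_upwards [h0] with y hy
    by_cases h : y = γ.toFun t
    · simp [h]
    · exact hy h
  refine limsup_le_of_le (by isBoundedDefault) ?_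
  filter_upwards [hspeed, hlim.eventually hslope] with s h1 h2
  refine ENNReal.div_le_of_le_mul (h2.trans ?_)
  rw [mul_assoc]
  gcongr

theorem enorm_le_metricSpeed_of_hasDerivAt (γ : ACCurve ℝ) {t d : ℝ} (ht : t ∈ Ioo γ.a γ.b)
    (hd : HasDerivAt γ.toFun d t) : ‖d‖ₑ ≤ γ.metricSpeed t := by
  have hfil : 𝓝[Icc γ.a γ.b \ {t}] t = 𝓝[≠] t := by
    rw [Set.sdiff_eq, inter_comm]
    exact nhdsWithin_inter_of_mem' (mem_nhdsWithin_of_mem_nhds (Icc_mem_nhds ht.1 ht.2))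
  have hlim : Tendsto (fun y => ‖slope γ.toFun t y‖ₑ) (𝓝[≠] t) (𝓝 ‖d‖ₑ) :=
    (continuous_enorm.tendsto _).comp (hasDerivAt_iff_tendsto_slope.1 hd)
  rw [metricSpeed, hfil, ← hlim.limsup_eq]
  refine limsup_le_limsup ?_
  filter_upwards [self_mem_nhdsWithin] with y hy
  rw [slope_def_field, div_eq_mul_inv, enorm_mul, enorm_inv (sub_ne_zero.2 hy), ← div_eq_mul_inv,
    ← edist_eq_enorm_sub, ← edist_eq_enorm_sub]

end ACCurve

section Slope

variable {X : Type*} [MetricSpace X]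

theorem localSlope_le_of_eventually {f : X → ℝ} {x : X} {c : ℝ≥0∞}
    (h : ∀ᶠ y in 𝓝 x, edist (f y) (f x) ≤ c * edist y x) : localSlope f x ≤ c := by
  refine limsup_le_of_le (by isBoundedDefault) ?_
  filter_upwards [mem_nhdsWithin_of_mem_nhds h] with y hy
  exact ENNReal.div_le_of_le_mul hy

theorem LipschitzWith.localSlope_le {f : X → ℝ} {K : ℝ≥0} (hf : LipschitzWith K f) (x : X) :
    localSlope f x ≤ K :=
  localSlope_le_of_eventually (Eventually.of_forall fun y => hf y x)

theorem localSlope_congr {f g : X → ℝ} {x : X} (h : f =ᶠ[𝓝 x] g) :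
    localSlope f x = localSlope g x := by
  refine limsup_congr (mem_nhdsWithin_of_mem_nhds ?_)
  filter_upwards [h] with y hy
  rw [hy, h.self_of_nhds]

/-- The slope is an upper gradient of a Lipschitz function along every absolutely continuous curve,
and so on each of its subcurves. -/
theorem ACCurve.edist_le_setLIntegral_localSlope (γ : ACCurve X) {f : X → ℝ} {K : ℝ≥0}
    (hf : LipschitzWith K f) {s t : ℝ} (hs : s ∈ Icc γ.a γ.b) (ht : t ∈ Icc γ.a γ.b)
    (hst : s ≤ t) :
    edist (f (γ.toFun s)) (f (γ.toFun t)) ≤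
      ∫⁻ r in Icc s t, localSlope f (γ.toFun r) * γ.metricSpeed r := by
  refine ((γ.compLipschitz f hf).edist_le_lintegral_metricSpeed hs ht hst).trans ?_
  refine setLIntegral_mono_ae' measurableSet_Icc ?_
  filter_upwards [γ.metricSpeed_lt_top_ae] with r hr hrI
  exact γ.metricSpeed_compLipschitz_le f hf (hr ⟨hs.1.trans hrI.1, hrI.2.trans ht.2⟩).ne
    ((hf.localSlope_le _).trans_lt ENNReal.coe_lt_top).ne

theorem ACCurve.edist_le_lineIntegral_localSlope (γ : ACCurve X) {f : X → ℝ} {K : ℝ≥0}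
    (hf : LipschitzWith K f) {s t : ℝ} (hs : s ∈ Icc γ.a γ.b) (ht : t ∈ Icc γ.a γ.b) :
    edist (f (γ.toFun s)) (f (γ.toFun t)) ≤ γ.lineIntegral (localSlope f) := by
  wlog hst : s ≤ t generalizing s t
  · rw [edist_comm]
    exact this ht hs (le_of_not_ge hst)
  exact (γ.edist_le_setLIntegral_localSlope hf hs ht hst).trans
    (lintegral_mono_set (Icc_subset_Icc hs.1 ht.2))

end Slope

/-! ### The modulus of a family of curves -/

section Modulus

variable {X : Type*} [MetricSpace X] [MeasurableSpace X] {m : Measure X} {p : ℝ}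

theorem pModulus_mono {Γ Γ' : Set (ACCurve X)} (h : Γ ⊆ Γ') :
    pModulus m p Γ ≤ pModulus m p Γ' :=
  le_iInf₂ fun g hg => le_iInf fun hΓ =>
    iInf₂_le_of_le g hg (iInf_le_of_le (fun γ hγ => hΓ γ (h hγ)) le_rfl)

theorem pModulus_le {Γ : Set (ACCurve X)} {g : X → ℝ≥0∞} (hg : Measurable g)
    (h : ∀ γ ∈ Γ, 1 ≤ γ.lineIntegral g) : pModulus m p Γ ≤ ∫⁻ x, g x ^ p ∂m :=
  iInf₂_le_of_le g hg (iInf_le _ h)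

theorem exists_of_pModulus_lt {Γ : Set (ACCurve X)} {c : ℝ≥0∞} (h : pModulus m p Γ < c) :
    ∃ g : X → ℝ≥0∞, Measurable g ∧ (∀ γ ∈ Γ, 1 ≤ γ.lineIntegral g) ∧ ∫⁻ x, g x ^ p ∂m < c := by
  simpa only [pModulus, iInf_lt_iff, exists_prop] using h

theorem pModulus_empty (hp : 0 < p) : pModulus m p (∅ : Set (ACCurve X)) = 0 :=
  le_antisymm ((pModulus_le (g := fun _ => 0) measurable_const (by simp)).trans
    (by simp [ENNReal.zero_rpow_of_pos hp])) zero_le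

/-- Countable unions of families of modulus zero: the supremum of the test functions is a test
function for the union, and its `p`-th power is at most the sum of theirs. -/
theorem pModulus_iUnion_eq_zero {ι : Type*} [Countable ι] (hp : 0 < p)
    {Γ : ι → Set (ACCurve X)} (h : ∀ i, pModulus m p (Γ i) = 0) :
    pModulus m p (⋃ i, Γ i) = 0 := by
  refine le_antisymm (ENNReal.le_of_forall_pos_le_add fun ε hε _ => ?_) zero_le
  obtain ⟨δ, hδ, hsum⟩ := ENNReal.exists_pos_sum_of_countable (ENNReal.coe_pos.2 hε).ne' ι
  have : ∀ i, ∃ g : X → ℝ≥0∞, Measurable g ∧ (∀ γ ∈ Γ i, 1 ≤ γ.lineIntegral g) ∧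
      ∫⁻ x, g x ^ p ∂m < δ i := fun i => exists_of_pModulus_lt (by simpa [h i] using hδ i)
  choose g hg hΓ hint using this
  rw [zero_add]
  refine (pModulus_le (g := fun x => ⨆ i, g i x) (Measurable.iSup hg) ?_).trans ?_
  · intro γ hγ
    obtain ⟨i, hi⟩ := mem_iUnion.1 hγ
    refine (hΓ i γ hi).trans (lintegral_mono fun s => ?_)
    dsimp only
    gcongr
    exact le_iSup (fun i => g i (γ.toFun s)) i
  · calc ∫⁻ x, (⨆ i, g i x) ^ p ∂m ≤ ∫⁻ x, ∑' i, g i x ^ p ∂m := by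
          refine lintegral_mono fun x => ?_
          rw [← ENNReal.le_rpow_inv_iff hp]
          exact iSup_le fun i => (ENNReal.le_rpow_inv_iff hp).2
            (ENNReal.le_tsum (f := fun i => g i x ^ p) i)
      _ = ∑' i, ∫⁻ x, g i x ^ p ∂m := lintegral_tsum fun i => ((hg i).pow_const p).aemeasurable
      _ ≤ ∑' i, (δ i : ℝ≥0∞) := ENNReal.tsum_le_tsum fun i => (hint i).le
      _ ≤ ε := hsum.le

end Modulus

/-! ### Segments in normed spaces -/

section Normed

variable {E : Type*} [NormedAddCommGroup E] [NormedSpace ℝ E]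

/-- The curve `r ↦ x + r v` on `[s, t]`. -/
def ACCurve.segment (x v : E) {s t : ℝ} (hst : s ≤ t) : ACCurve E where
  a := s
  b := t
  a_le_b := hst
  toFun := fun r => x + r • v
  absCont := by
    refine ⟨fun _ => ‖v‖, by simp, fun r _ r' _ h => ?_⟩
    rw [dist_add_left, dist_eq_norm, ← sub_smul, norm_smul, Real.norm_eq_abs, abs_sub_comm,
      abs_of_nonneg (sub_nonneg.2 h)]
    simp

theorem ACCurve.metricSpeed_segment_le (x v : E) {s t : ℝ} (hst : s ≤ t) (r : ℝ) :
    (ACCurve.segment x v hst).metricSpeed r ≤ ‖v‖ₑ := by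
  refine limsup_le_of_le (by isBoundedDefault) (Eventually.of_forall fun r' => ?_)
  refine ENNReal.div_le_of_le_mul (le_of_eq ?_)
  simp only [segment]
  rw [edist_add_left, edist_eq_enorm_sub, ← sub_smul, enorm_smul, mul_comm, edist_eq_enorm_sub]

theorem ACCurve.lineIntegral_segment_le (x v : E) {s t : ℝ} (hst : s ≤ t) (g : E → ℝ≥0∞) :
    (ACCurve.segment x v hst).lineIntegral g ≤ ∫⁻ r in Icc s t, g (x + r • v) * ‖v‖ₑ := by
  refine lintegral_mono fun r => ?_
  dsimp only [segment]
  gcongr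
  exact metricSpeed_segment_le x v hst r

theorem edist_le_lintegral_localSlope_segment {f : E → ℝ} {K : ℝ≥0} (hf : LipschitzWith K f)
    (x v : E) {s t : ℝ} (hst : s ≤ t) :
    edist (f (x + s • v)) (f (x + t • v)) ≤
      ∫⁻ r in Icc s t, localSlope f (x + r • v) * ‖v‖ₑ :=
  ((ACCurve.segment x v hst).edist_le_lineIntegral_localSlope hf (left_mem_Icc.2 hst)
    (right_mem_Icc.2 hst)).trans (ACCurve.lineIntegral_segment_le x v hst _)

theorem localSlope_le_enorm_fderiv {f : E → ℝ} {x : E} (hf : DifferentiableAt ℝ f x) :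
    localSlope f x ≤ ‖fderiv ℝ f x‖ₑ := by
  refine ENNReal.le_of_forall_pos_le_add fun ε hε _ => localSlope_le_of_eventually ?_
  filter_upwards [hf.hasFDerivAt.isLittleO.def (NNReal.coe_pos.2 hε)] with y hy
  have h1 : ‖f y - f x‖ ≤ (‖fderiv ℝ f x‖ + ε) * ‖y - x‖ := by
    have h2 := (fderiv ℝ f x).le_opNorm (y - x)
    have h3 := norm_le_norm_add_norm_sub' (f y - f x) (fderiv ℝ f x (y - x))
    linarith
  have h2 : ‖f y - f x‖ₑ ≤ ENNReal.ofReal ((‖fderiv ℝ f x‖ + ε) * ‖y - x‖) := by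
    rw [← ofReal_norm]
    exact ENNReal.ofReal_le_ofReal h1
  rw [edist_eq_enorm_sub, edist_eq_enorm_sub]
  refine h2.trans (le_of_eq ?_)
  rw [ENNReal.ofReal_mul (by positivity), ENNReal.ofReal_add (by positivity) (by positivity),
    ofReal_norm, ofReal_norm, ENNReal.ofReal_coe_nnreal]

/-- The slope of a continuous function is Borel: it is an infimum over the radii `1 / (k + 1)` of
suprema of continuous difference quotients, and these suprema are lower semicontinuous. -/
theorem measurable_localSlope {E : Type*} [NormedAddCommGroup E] [MeasurableSpace E] [BorelSpace E]
    {f : E → ℝ} (hf : Continuous f) :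
    Measurable (localSlope f) := by
  have key : localSlope f = fun x => ⨅ k : ℕ, ⨆ h : {h : E // h ≠ 0 ∧ ‖h‖ < 1 / ((k : ℝ) + 1)},
      edist (f (x + h)) (f x) / ‖(h : E)‖ₑ := by
    ext x
    have hb : (𝓝[≠] x).HasAntitoneBasis
        fun k : ℕ => Metric.ball x (1 / ((k : ℝ) + 1)) ∩ {x}ᶜ := by
      refine ⟨nhdsWithin_hasBasis ?_ _, ?_⟩
      · exact Metric.nhds_basis_ball_inv_nat_succ
      · intro k l hkl
        dsimp only
        gcongr
    rw [localSlope, hb.1.limsup_eq_iInf_iSup]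
    simp only [iInf_pos]
    refine iInf_congr fun k => le_antisymm ?_ ?_
    · refine iSup₂_le fun y hy => ?_
      refine le_iSup_of_le ⟨y - x, sub_ne_zero.2 hy.2, by simpa [dist_eq_norm] using hy.1⟩ ?_
      simp [edist_eq_enorm_sub y x]
    · refine iSup_le fun h => ?_
      refine le_iSup₂_of_le (x + h) ⟨?_, ?_⟩ ?_
      · simpa using h.2.2
      · simpa using h.2.1
      · simp [edist_eq_enorm_sub (x + (h : E)) x]
  rw [key]
  refine Measurable.iInf fun k => LowerSemicontinuous.measurable ?_
  refine lowerSemicontinuous_iSup fun h => Continuous.lowerSemicontinuous ?_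
  refine ENNReal.continuous_div_const _ ?_ |>.comp (by fun_prop)
  simpa using h.2.1

end Normed


/-! ### The Poincaré inequality for the Lebesgue measure -/

section ConvexPoincare

variable {E : Type*} [NormedAddCommGroup E] [NormedSpace ℝ E] [FiniteDimensional ℝ E]
  [MeasurableSpace E] [BorelSpace E] (ν : Measure E) [ν.IsAddHaarMeasure]

/-- A homothety of ratio `t ∈ [1/2, 1]` centred in a convex set maps the set into itself and shrinks
volumes by the factor `t ^ dim E`. -/
theorem setLIntegral_homothety_le {S : Set E} (hS : Convex ℝ S) (hSm : MeasurableSet S)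
    {g : E → ℝ≥0∞} (hg : Measurable g) {y : E} (hy : y ∈ S) {t : ℝ} (ht : t ∈ Icc (1 / 2 : ℝ) 1) :
    ∫⁻ z in S, g (y + t • (z - y)) ∂ν ≤ 2 ^ Module.finrank ℝ E * ∫⁻ z in S, g z ∂ν := by
  have ht0 : 0 < t := by linarith [ht.1]
  have hGm : Measurable (S.indicator g) := hg.indicator hSm
  calc ∫⁻ z in S, g (y + t • (z - y)) ∂ν
      ≤ ∫⁻ z in S, S.indicator g (t • z + (y - t • y)) ∂ν := by
        refine setLIntegral_mono' hSm fun z hz => ?_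
        have hmem : y + t • (z - y) ∈ S := hS.add_smul_sub_mem hy hz ⟨ht0.le, ht.2⟩
        have e : t • z + (y - t • y) = y + t • (z - y) := by rw [smul_sub]; abel
        rw [e, indicator_of_mem hmem]
    _ ≤ ∫⁻ z, S.indicator g (t • z + (y - t • y)) ∂ν := setLIntegral_le_lintegral _ _
    _ = ∫⁻ z, S.indicator g (z + (y - t • y)) ∂(Measure.map (t • ·) ν) := by
        rw [lintegral_map (f := fun z => S.indicator g (z + (y - t • y)))
          (hGm.comp (measurable_add_const _)) (measurable_const_smul t)]
    _ = ENNReal.ofReal (abs (t ^ Module.finrank ℝ E)⁻¹) * ∫⁻ z in S, g z ∂ν := by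
        rw [Measure.map_addHaar_smul ν ht0.ne', lintegral_smul_measure,
          lintegral_add_right_eq_self (μ := ν) (S.indicator g),
          lintegral_indicator hSm, smul_eq_mul]
    _ ≤ _ := by
        gcongr
        rw [abs_of_pos (by positivity), ← inv_pow, ENNReal.ofReal_pow (by positivity)]
        gcongr
        rw [show (2 : ℝ≥0∞) = ENNReal.ofReal 2 by simp]
        refine ENNReal.ofReal_le_ofReal ?_
        rw [inv_le_comm₀ ht0 two_pos]
        linarith [ht.1]

/-- The `(1, 1)`-Poincaré inequality on a bounded convex set, without averages. Each of `y`, `z` is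
joined to the midpoint by half of the segment `[y, z]`, on which the homothety centred at the other
endpoint has ratio at least `1/2`. -/
theorem lintegral_lintegral_edist_le {S : Set E} (hS : Convex ℝ S) (hSm : MeasurableSet S)
    {f : E → ℝ} {K : ℝ≥0} (hf : LipschitzWith K f) {d : ℝ≥0∞}
    (hd : ∀ y ∈ S, ∀ z ∈ S, ‖z - y‖ₑ ≤ d) :
    ∫⁻ y in S, ∫⁻ z in S, edist (f y) (f z) ∂ν ∂ν ≤
      2 ^ Module.finrank ℝ E * d * ν S * ∫⁻ z in S, localSlope f z ∂ν := by
  have hfc := hf.continuous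
  have hgm := measurable_localSlope hfc
  -- `A y z` is the oscillation of `f` over the half of `[y, z]` next to `z`.
  set A : E → E → ℝ≥0∞ := fun y z =>
    edist (f (y + (1 / 2 : ℝ) • (z - y))) (f (y + (1 : ℝ) • (z - y))) with hA
  have hAm : Measurable (Function.uncurry A) := by
    apply Continuous.measurable
    simp only [hA, Function.uncurry_def]
    fun_prop
  have hAint : ∫⁻ y in S, ∫⁻ z in S, A y z ∂ν ∂ν ≤
      ν S * (2⁻¹ * (2 ^ Module.finrank ℝ E * (∫⁻ z in S, localSlope f z ∂ν) * d)) := by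
    rw [mul_comm (ν S), ← setLIntegral_const]
    refine setLIntegral_mono' hSm fun y hy => ?_
    calc ∫⁻ z in S, A y z ∂ν
        ≤ ∫⁻ z in S,
            ∫⁻ r in Icc (1 / 2 : ℝ) 1, (localSlope f (y + r • (z - y)) * d) ∂volume ∂ν := by
          refine setLIntegral_mono' hSm fun z hz => ?_
          refine (edist_le_lintegral_localSlope_segment hf y (z - y) (by norm_num)).trans ?_
          gcongr
          exact hd y hy z hz
      _ = ∫⁻ r in Icc (1 / 2 : ℝ) 1, ∫⁻ z in S, localSlope f (y + r • (z - y)) * d ∂ν := by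
          refine lintegral_lintegral_swap (Measurable.aemeasurable ?_)
          have : Measurable fun q : E × ℝ => y + q.2 • (q.1 - y) := by fun_prop
          exact (hgm.comp this).mul_const d
      _ ≤ ∫⁻ r in Icc (1 / 2 : ℝ) 1,
            2 ^ Module.finrank ℝ E * (∫⁻ z in S, localSlope f z ∂ν) * d := by
          refine setLIntegral_mono' measurableSet_Icc fun r hr => ?_
          have : Measurable fun z : E => y + r • (z - y) := by fun_prop
          rw [lintegral_mul_const (f := fun z => localSlope f (y + r • (z - y))) _ (hgm.comp this)]
          gcongr
          exact setLIntegral_homothety_le ν hS hSm hgm hy hr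
      _ = _ := by
          rw [setLIntegral_const, Real.volume_Icc, mul_comm]
          congr 1
          rw [show (1 : ℝ) - 1 / 2 = 2⁻¹ by norm_num, ENNReal.ofReal_inv_of_pos two_pos]
          simp
  calc ∫⁻ y in S, ∫⁻ z in S, edist (f y) (f z) ∂ν ∂ν
      ≤ ∫⁻ y in S, ∫⁻ z in S, (A z y + A y z) ∂ν ∂ν := by
        refine lintegral_mono fun y => lintegral_mono fun z => ?_
        have e : z + (1 / 2 : ℝ) • (y - z) = y + (1 / 2 : ℝ) • (z - y) := by module
        simp only [hA, e, one_smul, add_sub_cancel]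
        rw [edist_comm _ (f y)]
        exact edist_triangle _ _ _
    _ = (∫⁻ y in S, ∫⁻ z in S, A z y ∂ν ∂ν) + ∫⁻ y in S, ∫⁻ z in S, A y z ∂ν ∂ν := by
        rw [← lintegral_add_right (g := fun y => ∫⁻ z in S, A y z ∂ν) _ hAm.lintegral_prod_right']
        refine lintegral_congr fun y => ?_
        exact lintegral_add_right (fun z => A z y) (hAm.comp measurable_prodMk_left)
    _ = 2 * ∫⁻ y in S, ∫⁻ z in S, A y z ∂ν ∂ν := by
        rw [lintegral_lintegral_swap (f := fun y z => A z y)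
          (hAm.comp measurable_swap).aemeasurable, two_mul]
    _ ≤ 2 * (ν S * (2⁻¹ * (2 ^ Module.finrank ℝ E * (∫⁻ z in S, localSlope f z ∂ν) * d))) := by
        gcongr
    _ = (2 * 2⁻¹) * (2 ^ Module.finrank ℝ E * d * ν S * ∫⁻ z in S, localSlope f z ∂ν) := by ring
    _ = _ := by rw [ENNReal.mul_inv_cancel two_ne_zero ENNReal.ofNat_ne_top, one_mul]

end ConvexPoincare

/-! ### Integrals over balls of functions of one coordinate -/

section Cylinder

variable {n : ℕ}

theorem EuclideanSpace.setLIntegral_ball_comp_coord_le (j : Fin n) {φ : ℝ → ℝ≥0∞}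
    (hφ : Measurable φ) (x : EuclideanSpace ℝ (Fin n)) (r : ℝ) :
    ∫⁻ y in Metric.ball x r, φ (y j) ≤
      ENNReal.ofReal (2 * r) ^ (n - 1) * ∫⁻ t in Ioo (x j - r) (x j + r), φ t := by
  set S : Set (Fin n → ℝ) := Set.pi univ fun i => Ioo (x i - r) (x i + r) with hS
  have hsub : Metric.ball x r ⊆ (WithLp.ofLp : EuclideanSpace ℝ (Fin n) → (Fin n → ℝ)) ⁻¹' S := by
    intro y hy i _
    have h1 : ‖(y - x) i‖ ≤ ‖y - x‖ := PiLp.norm_apply_le _ _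
    have h2 : ‖y - x‖ < r := by simpa [dist_eq_norm] using hy
    have h3 := abs_lt.1 (h1.trans_lt h2)
    simp only [PiLp.sub_apply] at h3
    exact ⟨by linarith, by linarith⟩
  have hSm : MeasurableSet S := MeasurableSet.univ_pi fun i => measurableSet_Ioo
  refine (lintegral_mono_set hsub).trans ?_
  rw [(PiLp.volume_preserving_ofLp (Fin n)).setLIntegral_comp_preimage hSm
    (f := fun z => φ (z j)) (hφ.comp (measurable_pi_apply j)), hS, volume_pi,
    Measure.restrict_pi_pi]
  rw [← lintegral_map (f := φ) (g := fun z : Fin n → ℝ => z j) hφ (measurable_pi_apply j)]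
  have hmap := Measure.pi_map_eval
    (fun i : Fin n => (volume : Measure ℝ).restrict (Ioo (x i - r) (x i + r))) j
  rw [show (fun z : Fin n → ℝ => z j) = Function.eval j from rfl, hmap, lintegral_smul_measure,
    smul_eq_mul]
  refine le_of_eq ?_
  congr 1
  have : ∀ i : Fin n,
      (volume.restrict (Ioo (x i - r) (x i + r))) univ = ENNReal.ofReal (2 * r) := by
    intro i
    rw [Measure.restrict_apply_univ, Real.volume_Ioo]
    congr 1
    ring
  simp [this]

theorem setLIntegral_enorm_rpow_neg_le {s : ℝ} (hs1 : s < 1) (q : ℝ) {R : ℝ} (hR : 0 < R) :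
    ∫⁻ t in Ioo (q - R) (q + R), ‖t - q‖ₑ ^ (-s) ≤ 2 * ENNReal.ofReal (R ^ (1 - s) / (1 - s)) := by
  have hpos : ∫⁻ u in Ioc 0 R, ‖u‖ₑ ^ (-s) ≤ ENNReal.ofReal (R ^ (1 - s) / (1 - s)) := by
    have hint : IntervalIntegrable (fun u : ℝ => u ^ (-s)) volume 0 R :=
      intervalIntegral.intervalIntegrable_rpow' (by linarith)
    have h1 : ∫ u in (0 : ℝ)..R, u ^ (-s) = R ^ (1 - s) / (1 - s) := by
      rw [integral_rpow (Or.inl (by linarith)), Real.zero_rpow (by linarith)]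
      rw [show -s + 1 = 1 - s by ring, sub_zero]
    rw [← h1, intervalIntegral.integral_of_le hR.le, ofReal_integral_eq_lintegral_ofReal
      ((intervalIntegrable_iff_integrableOn_Ioc_of_le hR.le).1 hint)]
    · refine le_of_eq (setLIntegral_congr_fun measurableSet_Ioc fun u hu => ?_)
      rw [Real.enorm_eq_ofReal hu.1.le, ENNReal.ofReal_rpow_of_pos hu.1]
    · refine (ae_restrict_iff' measurableSet_Ioc).2 (Eventually.of_forall fun u hu => ?_)
      exact Real.rpow_nonneg hu.1.le _
  have hneg : ∫⁻ u in Ico (-R) 0, ‖u‖ₑ ^ (-s) = ∫⁻ u in Ioc 0 R, ‖u‖ₑ ^ (-s) := by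
    have h := (Measure.measurePreserving_neg (volume : Measure ℝ)).setLIntegral_comp_preimage
      (s := Ioc 0 R) measurableSet_Ioc (f := fun u => ‖u‖ₑ ^ (-s)) (by fun_prop)
    rw [← h]
    simp
  have htrans : ∫⁻ t in Ioo (q - R) (q + R), ‖t - q‖ₑ ^ (-s) = ∫⁻ u in Ioo (-R) R, ‖u‖ₑ ^ (-s) := by
    have h := (measurePreserving_sub_right (volume : Measure ℝ) q).setLIntegral_comp_preimage
      (s := Ioo (-R) R) measurableSet_Ioo (f := fun u => ‖u‖ₑ ^ (-s)) (by fun_prop)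
    rw [← h]
    simp [add_comm, sub_eq_neg_add]
  rw [htrans, two_mul]
  calc ∫⁻ u in Ioo (-R) R, ‖u‖ₑ ^ (-s)
      ≤ ∫⁻ u in (Ico (-R) 0 ∪ {0}) ∪ Ioc 0 R, ‖u‖ₑ ^ (-s) := by
        refine lintegral_mono_set fun u hu => ?_
        rcases lt_trichotomy u 0 with h | h | h
        · exact Or.inl (Or.inl ⟨hu.1.le, h⟩)
        · exact Or.inl (Or.inr h)
        · exact Or.inr ⟨h, hu.2.le⟩
    _ ≤ ((∫⁻ u in Ico (-R) 0, ‖u‖ₑ ^ (-s)) + ∫⁻ u in {(0 : ℝ)}, ‖u‖ₑ ^ (-s))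
          + ∫⁻ u in Ioc 0 R, ‖u‖ₑ ^ (-s) :=
        (lintegral_union_le _ _ _).trans (by gcongr; exact lintegral_union_le _ _ _)
    _ ≤ _ := by
        rw [Measure.restrict_singleton]
        simp only [Real.volume_singleton, zero_smul, lintegral_zero_measure, add_zero]
        rw [hneg]
        gcongr

/-- The singularity `|y_j - q| ^ (-s)` on a ball whose centre is close to the hyperplane `y_j = q`
has average at most a constant times `r ^ (-s)`. -/
theorem exists_setLIntegral_ball_coord_rpow_neg_le (n : ℕ) {s : ℝ} (hs1 : s < 1) :
    ∃ K : ℝ≥0, ∀ (j : Fin n) (x : EuclideanSpace ℝ (Fin n)) (r q : ℝ), 0 < r →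
      |x j - q| < 2 * r →
      ∫⁻ y in Metric.ball x r, ‖y j - q‖ₑ ^ (-s) ≤
        K * volume (Metric.ball x r) * ENNReal.ofReal r ^ (-s) := by
  set v := volume (Metric.ball (0 : EuclideanSpace ℝ (Fin n)) 1) with hv
  have hv0 : v ≠ 0 := (Metric.measure_ball_pos _ _ one_pos).ne'
  have hvt : v ≠ ∞ := measure_ball_lt_top.ne
  have hc : (2 : ℝ≥0∞) ^ (n - 1) * (2 * ENNReal.ofReal (3 ^ (1 - s) / (1 - s))) / v ≠ ∞ := by
    exact ENNReal.div_ne_top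
      (ENNReal.mul_ne_top (by simp) (ENNReal.mul_ne_top (by simp) (by simp))) hv0
  refine ⟨((2 : ℝ≥0∞) ^ (n - 1) * (2 * ENNReal.ofReal (3 ^ (1 - s) / (1 - s))) / v).toNNReal, ?_⟩
  intro j x r q hr hxq
  have hn : 0 < n := j.pos
  rw [ENNReal.coe_toNNReal hc]
  have hball : volume (Metric.ball x r) = ENNReal.ofReal r ^ n * v := by
    rw [Measure.addHaar_ball_of_pos volume x hr, finrank_euclideanSpace, Fintype.card_fin,
      ENNReal.ofReal_pow hr.le]
  have h1 : ∫⁻ t in Ioo (x j - r) (x j + r), ‖t - q‖ₑ ^ (-s) ≤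
      2 * ENNReal.ofReal ((3 * r) ^ (1 - s) / (1 - s)) := by
    refine (lintegral_mono_set ?_).trans (setLIntegral_enorm_rpow_neg_le hs1 q (by positivity))
    obtain ⟨ha, hb⟩ := abs_lt.1 hxq
    exact Ioo_subset_Ioo (by linarith) (by linarith)
  have h2 := EuclideanSpace.setLIntegral_ball_comp_coord_le j (φ := fun t => ‖t - q‖ₑ ^ (-s))
    (by fun_prop) x r
  refine h2.trans ((mul_le_mul_right h1 _).trans (le_of_eq ?_))
  have hρ0 : ENNReal.ofReal r ≠ 0 := by simpa using hr
  rw [hball, Real.mul_rpow (by norm_num) hr.le, ENNReal.ofReal_mul zero_le_two, mul_pow,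
    mul_div_right_comm, ENNReal.ofReal_mul (div_nonneg (by positivity) (by linarith)),
    ← ENNReal.ofReal_rpow_of_pos hr, sub_eq_add_neg 1 s,
    ENNReal.rpow_add _ _ hρ0 ENNReal.ofReal_ne_top, ENNReal.rpow_one]
  obtain ⟨k, rfl⟩ : ∃ k, n = k + 1 := ⟨n - 1, by omega⟩
  rw [Nat.add_sub_cancel, pow_succ, ENNReal.ofReal_ofNat, ENNReal.div_eq_inv_mul]
  generalize ENNReal.ofReal r = ρ
  generalize ENNReal.ofReal (3 ^ (1 + -s) / (1 + -s)) = b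
  calc 2 ^ k * ρ ^ k * (2 * (b * (ρ * ρ ^ (-s))))
      = (v⁻¹ * v) * (2 ^ k * ρ ^ k * (2 * (b * (ρ * ρ ^ (-s))))) := by
        rw [ENNReal.inv_mul_cancel hv0 hvt, one_mul]
    _ = _ := by ring

end Cylinder


/-! ### The weight and its `A₁`-type estimate -/

/-- A dense sequence of real numbers. -/
def denseReal : ℕ → ℝ := TopologicalSpace.denseSeq ℝ

/-- The function `max 1 (sup_{j, i} 2^{-i} / |x_j - q_i|)`, where `q = denseReal`.
It is infinite on a dense set of hyperplanes parallel to the coordinate hyperplanes. The maximum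
with `1` bounds the weight and makes it positive in dimension `0`, where the supremum is empty. -/
def singularSup {n : ℕ} (x : EuclideanSpace ℝ (Fin n)) : ℝ≥0∞ :=
  max 1 (⨆ (j : Fin n) (i : ℕ), 2⁻¹ ^ i / ‖x j - denseReal i‖ₑ)

/-- The weight `w = min 1 (inf_{j, i} (2^i |x_j - q_i|) ^ α)`. It vanishes where `singularSup` is
infinite; as `singularSup ≥ 1`, the conversion to `ℝ≥0` never meets the value `∞`. -/
def singularWeight (n : ℕ) (α : ℝ) (x : EuclideanSpace ℝ (Fin n)) : ℝ≥0 :=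
  (singularSup x ^ (-α)).toNNReal

/-- The measure with density `singularWeight n α`. -/
def singularMeasure (n : ℕ) (α : ℝ) : Measure (EuclideanSpace ℝ (Fin n)) :=
  volume.withDensity fun x => (singularWeight n α x : ℝ≥0∞)

/-- A geometric series restricted to its terms below `A` is dominated by `A`. -/
theorem ENNReal.tsum_geometric_ite_le (ρ A : ℝ≥0∞) :
    ∑' i : ℕ, (if ρ ^ i ≤ A then ρ ^ i else 0) ≤ A * (1 - ρ)⁻¹ := by
  classical
  by_cases h : ∃ i : ℕ, ρ ^ i ≤ A
  swap
  · push Not at h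
    simp [fun i => (h i).not_ge]
  rw [← ENNReal.summable.sum_add_tsum_nat_add' (k := Nat.find h), Finset.sum_eq_zero, zero_add,
    ← ENNReal.tsum_geometric, ← ENNReal.tsum_mul_left]
  · refine ENNReal.tsum_le_tsum fun i => ?_
    split_ifs
    · rw [add_comm, pow_add]
      gcongr
      exact Nat.find_spec h
    · exact zero_le
  · intro i hi
    rw [if_neg (Nat.find_min h (Finset.mem_range.1 hi))]

section Weight

variable {n : ℕ} {α : ℝ}

theorem one_le_singularSup (x : EuclideanSpace ℝ (Fin n)) : 1 ≤ singularSup x := le_max_left _ _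

theorem singularSup_ne_zero (x : EuclideanSpace ℝ (Fin n)) : singularSup x ≠ 0 :=
  (zero_lt_one.trans_le (one_le_singularSup x)).ne'

theorem le_singularSup (x : EuclideanSpace ℝ (Fin n)) (j : Fin n) (i : ℕ) :
    2⁻¹ ^ i / ‖x j - denseReal i‖ₑ ≤ singularSup x :=
  (le_iSup₂ (f := fun (j : Fin n) (i : ℕ) => (2⁻¹ : ℝ≥0∞) ^ i / ‖x j - denseReal i‖ₑ) j i).trans
    (le_max_right _ _)

theorem measurable_singularSup : Measurable (singularSup : EuclideanSpace ℝ (Fin n) → ℝ≥0∞) := by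
  refine measurable_const.max (Measurable.iSup fun j => Measurable.iSup fun i => ?_)
  have : Measurable fun x : EuclideanSpace ℝ (Fin n) => ‖x j - denseReal i‖ₑ :=
    (((PiLp.continuous_apply 2 _ j).sub continuous_const).enorm).measurable
  exact measurable_const.div this

theorem singularSup_rpow_neg_le_one (hα : 0 < α) (x : EuclideanSpace ℝ (Fin n)) :
    singularSup x ^ (-α) ≤ 1 :=
  ENNReal.rpow_le_one_of_one_le_of_neg (one_le_singularSup x) (by linarith)

theorem coe_singularWeight (hα : 0 < α) (x : EuclideanSpace ℝ (Fin n)) :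
    (singularWeight n α x : ℝ≥0∞) = singularSup x ^ (-α) :=
  ENNReal.coe_toNNReal ((singularSup_rpow_neg_le_one hα x).trans_lt ENNReal.one_lt_top).ne

theorem measurable_singularWeight : Measurable (singularWeight n α) :=
  (measurable_singularSup.pow_const _).ennreal_toNNReal

theorem coe_singularWeight_le_one (hα : 0 < α) (x : EuclideanSpace ℝ (Fin n)) :
    (singularWeight n α x : ℝ≥0∞) ≤ 1 := by
  rw [coe_singularWeight hα]
  exact singularSup_rpow_neg_le_one hα x

theorem singularWeight_mul_le_one (hα : 0 < α) (x : EuclideanSpace ℝ (Fin n)) :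
    (singularWeight n α x : ℝ≥0∞) * singularSup x ^ α ≤ 1 := by
  rw [coe_singularWeight hα, ENNReal.rpow_neg]
  exact ENNReal.inv_mul_le_one _

theorem setLIntegral_singularMeasure {S : Set (EuclideanSpace ℝ (Fin n))}
    (hS : MeasurableSet S) {g : EuclideanSpace ℝ (Fin n) → ℝ≥0∞}
    (hg : Measurable g) :
    ∫⁻ x in S, g x ∂(singularMeasure n α) = ∫⁻ x in S, singularWeight n α x * g x := by
  rw [singularMeasure, restrict_withDensity hS,
    lintegral_withDensity_eq_lintegral_mul _ measurable_singularWeight.coe_nnreal_ennreal hg]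
  rfl

theorem singularMeasure_apply {S : Set (EuclideanSpace ℝ (Fin n))} (hS : MeasurableSet S) :
    singularMeasure n α S = ∫⁻ x in S, singularWeight n α x :=
  withDensity_apply _ hS

theorem singularMeasure_le (hα : 0 < α) {S : Set (EuclideanSpace ℝ (Fin n))}
    (hS : MeasurableSet S) :
    singularMeasure n α S ≤ volume S := by
  rw [singularMeasure_apply hS, ← setLIntegral_one]
  exact lintegral_mono fun x => coe_singularWeight_le_one hα x

theorem singularMeasure_ball_lt_top (hα : 0 < α) (x : EuclideanSpace ℝ (Fin n)) (r : ℝ) :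
    singularMeasure n α (Metric.ball x r) < ∞ :=
  (singularMeasure_le hα measurableSet_ball).trans_lt measure_ball_lt_top

/-- Split the hyperplanes into those far from a ball, along which `singularSup` is at most `D` on
the ball, and those near to it, whose coefficients are at most `A`. The coefficients of the
latter form a subset of a geometric series, so that their sum is comparable to `A`. -/
theorem exists_setLIntegral_singularSup_rpow_le (n : ℕ) {s : ℝ} (hs0 : 0 < s) (hs1 : s < 1) :
    ∃ K : ℝ≥0, ∀ (x : EuclideanSpace ℝ (Fin n)) (r : ℝ) (D A : ℝ≥0∞), 0 < r → 1 ≤ D →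
      (∀ j i, 2 * r ≤ |x j - denseReal i| → ∀ y ∈ Metric.ball x r,
        2⁻¹ ^ i / ‖y j - denseReal i‖ₑ ≤ D) →
      (∀ j i, |x j - denseReal i| < 2 * r → 2⁻¹ ^ i ≤ A) →
      ∫⁻ y in Metric.ball x r, singularSup y ^ s ≤
        (D ^ s + K * (A / ENNReal.ofReal r) ^ s) * volume (Metric.ball x r) := by
  obtain ⟨K, hK⟩ := exists_setLIntegral_ball_coord_rpow_neg_le n hs1
  have hρ1 : (2⁻¹ : ℝ≥0∞) ^ s < 1 := ENNReal.rpow_lt_one (by simp) hs0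
  have hc : (n : ℝ≥0∞) * K * (1 - (2⁻¹ : ℝ≥0∞) ^ s)⁻¹ ≠ ∞ :=
    ENNReal.mul_ne_top (ENNReal.mul_ne_top (by simp) (by simp))
      (ENNReal.inv_ne_top.2 (tsub_pos_of_lt hρ1).ne')
  refine ⟨((n : ℝ≥0∞) * K * (1 - (2⁻¹ : ℝ≥0∞) ^ s)⁻¹).toNNReal, ?_⟩
  intro x r D A hr hD hfar hnear
  rw [ENNReal.coe_toNNReal hc]
  set B := Metric.ball x r
  set F : Fin n → ℕ → EuclideanSpace ℝ (Fin n) → ℝ≥0∞ := fun j i y =>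
    if |x j - denseReal i| < 2 * r then ((2⁻¹ : ℝ≥0∞) ^ i) ^ s * ‖y j - denseReal i‖ₑ ^ (-s)
    else 0 with hF
  have hFm : ∀ j i, Measurable (F j i) := by
    intro j i
    have : Measurable fun y : EuclideanSpace ℝ (Fin n) => ‖y j - denseReal i‖ₑ :=
      (((PiLp.continuous_apply 2 _ j).sub continuous_const).enorm).measurable
    simp only [hF]
    split_ifs
    · exact (this.pow_const _).const_mul _
    · exact measurable_const
  have hpt : ∀ y ∈ B, singularSup y ^ s ≤ D ^ s + ∑ j, ∑' i, F j i y := by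
    intro y hy
    rw [← ENNReal.le_rpow_inv_iff hs0]
    refine max_le (hD.trans ?_) (iSup₂_le fun j i => ?_)
    · rw [ENNReal.le_rpow_inv_iff hs0]
      exact le_self_add
    · rw [ENNReal.le_rpow_inv_iff hs0]
      rcases lt_or_ge (|x j - denseReal i|) (2 * r) with h | h
      · refine le_trans ?_ le_add_self
        refine le_trans ?_ (Finset.single_le_sum (f := fun j => ∑' i, F j i y)
          (fun _ _ => zero_le) (Finset.mem_univ j))
        refine le_trans (le_of_eq ?_) (ENNReal.le_tsum i)
        simp only [hF, if_pos h]
        rw [ENNReal.div_rpow_of_nonneg _ _ hs0.le, ENNReal.rpow_neg, div_eq_mul_inv]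
      · refine le_trans ?_ le_self_add
        gcongr
        exact hfar j i h y hy
  have hFint : ∀ j i, ∫⁻ y in B, F j i y ≤
      (if ((2⁻¹ : ℝ≥0∞) ^ s) ^ i ≤ A ^ s then ((2⁻¹ : ℝ≥0∞) ^ s) ^ i else 0) *
        (K * volume B * ENNReal.ofReal r ^ (-s)) := by
    intro j i
    simp only [hF]
    split_ifs with h1 h2 h2
    · have hm : Measurable fun y : EuclideanSpace ℝ (Fin n) => ‖y j - denseReal i‖ₑ :=
        (((PiLp.continuous_apply 2 _ j).sub continuous_const).enorm).measurable
      rw [lintegral_const_mul _ (hm.pow_const _), ← ENNReal.rpow_natCast, ← ENNReal.rpow_mul,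
        mul_comm (i : ℝ) s, ENNReal.rpow_mul, ENNReal.rpow_natCast]
      gcongr
      exact hK j x r (denseReal i) hr h1
    · refine absurd ?_ h2
      rw [← ENNReal.rpow_natCast, ← ENNReal.rpow_mul, mul_comm s, ENNReal.rpow_mul,
        ENNReal.rpow_natCast]
      gcongr
      exact hnear j i h1
    · simp
    · simp
  calc ∫⁻ y in B, singularSup y ^ s
      ≤ ∫⁻ y in B, (D ^ s + ∑ j, ∑' i, F j i y) := setLIntegral_mono' measurableSet_ball hpt
    _ = D ^ s * volume B + ∑ j, ∑' i, ∫⁻ y in B, F j i y := by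
        rw [lintegral_add_left measurable_const, setLIntegral_const, lintegral_finsetSum]
        · congr 1
          exact Finset.sum_congr rfl fun j _ => lintegral_tsum fun i => (hFm j i).aemeasurable
        · exact fun j _ => Measurable.tsum (hFm j)
    _ ≤ D ^ s * volume B + ∑ _j : Fin n, (A ^ s * (1 - (2⁻¹ : ℝ≥0∞) ^ s)⁻¹) *
          (K * volume B * ENNReal.ofReal r ^ (-s)) := by
        gcongr with j
        refine (ENNReal.tsum_le_tsum (hFint j)).trans ?_
        rw [ENNReal.tsum_mul_right]
        gcongr
        exact ENNReal.tsum_geometric_ite_le _ _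
    _ = _ := by
        rw [Finset.sum_const, Finset.card_univ, Fintype.card_fin, nsmul_eq_mul,
          ENNReal.div_rpow_of_nonneg _ _ hs0.le, ENNReal.rpow_neg, div_eq_mul_inv]
        ring

/-- Even without a point of the ball at which `singularSup` is known to be finite, the far
hyperplanes contribute at most `1 / r`, and all coefficients are at most `1`. -/
theorem setLIntegral_singularSup_rpow_lt_top {s : ℝ} (hs0 : 0 < s) (hs1 : s < 1)
    (x : EuclideanSpace ℝ (Fin n)) {r : ℝ} (hr : 0 < r) :
    ∫⁻ y in Metric.ball x r, singularSup y ^ s < ∞ := by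
  obtain ⟨K, hK⟩ := exists_setLIntegral_singularSup_rpow_le n hs0 hs1
  have hρ : (ENNReal.ofReal r)⁻¹ ≠ ∞ := ENNReal.inv_ne_top.2 (by simpa using hr)
  refine (hK x r (max 1 (ENNReal.ofReal r)⁻¹) 1 hr (le_max_left _ _) ?_ ?_).trans_lt ?_
  · intro j i h y hy
    refine le_trans ?_ (le_max_right _ _)
    rw [← one_div (ENNReal.ofReal r)]
    refine ENNReal.div_le_div (pow_le_one₀ zero_le (ENNReal.inv_le_one.2 one_le_two)) ?_
    rw [← ofReal_norm]
    refine ENNReal.ofReal_le_ofReal ?_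
    have h1 : ‖(y - x) j‖ ≤ ‖y - x‖ := PiLp.norm_apply_le _ _
    have h2 : ‖y - x‖ < r := by simpa [dist_eq_norm] using hy
    have h3 : |x j - denseReal i| ≤ |x j - y j| + |y j - denseReal i| := abs_sub_le _ _ _
    rw [PiLp.sub_apply, Real.norm_eq_abs, abs_sub_comm] at h1
    rw [Real.norm_eq_abs]
    linarith
  · intro j i _
    exact pow_le_one₀ zero_le (by simp)
  · refine ENNReal.mul_lt_top (ENNReal.add_lt_top.2 ⟨?_, ENNReal.mul_lt_top (by simp) ?_⟩)
      measure_ball_lt_top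
    · exact ENNReal.rpow_lt_top_of_nonneg hs0.le (max_lt (by simp) hρ.lt_top).ne
    · refine ENNReal.rpow_lt_top_of_nonneg hs0.le ?_
      rwa [one_div]

/-- For `0 < s < 1` the function `singularSup ^ s` is a Muckenhoupt `A₁`-weight, with the pointwise
infimum over the ball in place of the essential infimum. -/
theorem exists_setLIntegral_singularSup_rpow_le_mul (n : ℕ) {s : ℝ} (hs0 : 0 < s) (hs1 : s < 1) :
    ∃ C : ℝ≥0, ∀ (x : EuclideanSpace ℝ (Fin n)) (r : ℝ), 0 < r → ∀ z ∈ Metric.ball x r,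
      ∫⁻ y in Metric.ball x r, singularSup y ^ s ≤
        C * volume (Metric.ball x r) * singularSup z ^ s := by
  obtain ⟨K, hK⟩ := exists_setLIntegral_singularSup_rpow_le n hs0 hs1
  have hc : (3 : ℝ≥0∞) ^ s * (1 + K) ≠ ∞ :=
    ENNReal.mul_ne_top (ENNReal.rpow_ne_top_of_nonneg hs0.le (by simp)) (by simp)
  refine ⟨((3 : ℝ≥0∞) ^ s * (1 + K)).toNNReal, fun x r hr z hz => ?_⟩
  rw [ENNReal.coe_toNNReal hc]
  have hρ0 : ENNReal.ofReal r ≠ 0 := by simpa using hr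
  have hcoord : ∀ y ∈ Metric.ball x r, ∀ j, |y j - x j| < r := by
    intro y hy j
    have h1 : ‖(y - x) j‖ ≤ ‖y - x‖ := PiLp.norm_apply_le _ _
    exact h1.trans_lt (by simpa [dist_eq_norm] using hy)
  refine (hK x r (3 * singularSup z) (3 * singularSup z * ENNReal.ofReal r) hr ?_ ?_ ?_).trans ?_
  · exact (one_le_singularSup z).trans (le_mul_of_one_le_left zero_le (by norm_num))
  -- A far hyperplane is at comparable distances from all points of the ball.
  · intro j i h y hy
    calc 2⁻¹ ^ i / ‖y j - denseReal i‖ₑ ≤ 2⁻¹ ^ i / (‖z j - denseReal i‖ₑ / 3) := by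
          gcongr
          refine ENNReal.div_le_of_le_mul' ?_
          rw [← ofReal_norm, ← ofReal_norm, ← ENNReal.ofReal_ofNat 3,
            ← ENNReal.ofReal_mul (by norm_num)]
          refine ENNReal.ofReal_le_ofReal ?_
          simp only [Real.norm_eq_abs]
          have h1 := hcoord y hy j
          have h2 := hcoord z hz j
          have h3 : |x j - denseReal i| ≤ |x j - y j| + |y j - denseReal i| := abs_sub_le _ _ _
          have h4 : |z j - denseReal i| ≤ |z j - x j| + |x j - denseReal i| := abs_sub_le _ _ _
          rw [abs_sub_comm] at h1
          linarith
      _ = 3 * (2⁻¹ ^ i / ‖z j - denseReal i‖ₑ) := by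
          rw [div_eq_mul_inv, ENNReal.inv_div (by simp) (by simp), div_eq_mul_inv, div_eq_mul_inv]
          ring
      _ ≤ 3 * singularSup z := by gcongr; exact le_singularSup z j i
  -- A near hyperplane is at distance at most `3 r` from `z`.
  · intro j i h
    have h1 : ‖z j - denseReal i‖ₑ ≤ 3 * ENNReal.ofReal r := by
      rw [← ofReal_norm, ← ENNReal.ofReal_ofNat 3, ← ENNReal.ofReal_mul (by norm_num)]
      refine ENNReal.ofReal_le_ofReal ?_
      rw [Real.norm_eq_abs]
      have h2 := hcoord z hz j
      have h4 : |z j - denseReal i| ≤ |z j - x j| + |x j - denseReal i| := abs_sub_le _ _ _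
      linarith
    have h2 : 2⁻¹ ^ i / (3 * ENNReal.ofReal r) ≤ singularSup z :=
      (ENNReal.div_le_div_left h1 _).trans (le_singularSup z j i)
    rw [ENNReal.div_le_iff (mul_ne_zero (by simp) hρ0)
      (ENNReal.mul_ne_top (by simp) (by simp))] at h2
    exact h2.trans_eq (by ring)
  · rw [ENNReal.mul_div_cancel_right hρ0 ENNReal.ofReal_ne_top,
      ENNReal.mul_rpow_of_nonneg _ _ hs0.le]
    exact le_of_eq (by ring)

theorem ae_singularSup_lt_top : ∀ᵐ x : EuclideanSpace ℝ (Fin n), singularSup x < ∞ := by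
  have h : ∀ k : ℕ, ∀ᵐ x : EuclideanSpace ℝ (Fin n),
      x ∈ Metric.ball (0 : EuclideanSpace ℝ (Fin n)) (k + 1) → singularSup x < ∞ := by
    intro k
    have h1 := setLIntegral_singularSup_rpow_lt_top (n := n) (s := 1 / 2) (by norm_num)
      (by norm_num) 0 (r := k + 1) (by positivity)
    have h2 := ae_lt_top (measurable_singularSup.pow_const _) h1.ne
    rw [ae_restrict_iff' measurableSet_ball] at h2
    filter_upwards [h2] with x hx hxB
    by_contra hcon
    have : singularSup x = ∞ := by simpa using hcon
    have := hx hxB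
    simp_all
  filter_upwards [ae_all_iff.2 h] with x hx
  obtain ⟨k, hk⟩ := exists_nat_gt ‖x‖
  exact hx k (by simp; linarith)

end Weight


/-! ### The `A_p` condition, doubling and the Poincaré inequality -/

section Averages

variable {X : Type*} [MeasurableSpace X]

theorem edist_setAverage_le {m : Measure X} {S : Set X} {f : X → ℝ} (hf : IntegrableOn f S m)
    (h0 : m S ≠ 0) (ht : m S ≠ ∞) (c : ℝ) :
    edist c (⨍ z in S, f z ∂m) ≤ ⨍⁻ z in S, edist c (f z) ∂m := by
  have : NeZero (m.restrict S) := ⟨by simpa using h0⟩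
  have : IsFiniteMeasure (m.restrict S) := ⟨by simpa using ht.lt_top⟩
  have hi : Integrable f (((m.restrict S) univ)⁻¹ • m.restrict S) := hf.to_average
  rw [average, laverage, edist_eq_enorm_sub]
  have h1 : c - ∫ z, f z ∂(((m.restrict S) univ)⁻¹ • m.restrict S) =
      ∫ z, (c - f z) ∂(((m.restrict S) univ)⁻¹ • m.restrict S) := by
    have : IsProbabilityMeasure (((m.restrict S) univ)⁻¹ • m.restrict S) :=
      isProbabilityMeasureSMul
    rw [integral_sub (integrable_const c) hi, integral_const, probReal_univ, one_smul]
  rw [h1]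
  refine (enorm_integral_le_lintegral_enorm _).trans (le_of_eq ?_)
  simp only [edist_eq_enorm_sub]

end Averages

section MuckenhouptWeight

variable {n : ℕ} {α p : ℝ}

/-- Hölder's inequality, applied to `g = (g w ^ (1 / p)) w ^ (-1 / p)`. -/
theorem setLIntegral_rpow_le_singularMeasure (hα : 0 < α) (hp : 1 < p)
    {S : Set (EuclideanSpace ℝ (Fin n))} (hS : MeasurableSet S)
    {g : EuclideanSpace ℝ (Fin n) → ℝ≥0∞} (hg : Measurable g) :
    (∫⁻ x in S, g x) ^ p ≤ (∫⁻ x in S, g x ^ p ∂(singularMeasure n α)) *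
      (∫⁻ x in S, singularSup x ^ (α / (p - 1))) ^ (p - 1) := by
  have hp0 : 0 < p := by linarith
  have hp1 : p - 1 ≠ 0 := by linarith
  have hN := measurable_singularSup (n := n)
  have hconj : p.HolderConjugate (p / (p - 1)) := Real.HolderConjugate.conjExponent hp
  have hH := ENNReal.lintegral_mul_le_Lp_mul_Lq (volume.restrict S) hconj
    (f := fun x => g x * singularSup x ^ (-(α / p))) (g := fun x => singularSup x ^ (α / p))
    (hg.mul (hN.pow_const _)).aemeasurable (hN.pow_const _).aemeasurable
  have e1 : ∫⁻ x in S, g x * singularSup x ^ (-(α / p)) * singularSup x ^ (α / p) =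
      ∫⁻ x in S, g x := by
    refine lintegral_congr_ae (ae_restrict_of_ae ?_)
    filter_upwards [ae_singularSup_lt_top (n := n)] with x hx
    rw [mul_assoc, ← ENNReal.rpow_add _ _ (singularSup_ne_zero x) hx.ne]
    simp
  have e2 : ∫⁻ x in S, (g x * singularSup x ^ (-(α / p))) ^ p =
      ∫⁻ x in S, g x ^ p ∂(singularMeasure n α) := by
    rw [setLIntegral_singularMeasure hS (hg.pow_const p)]
    refine lintegral_congr fun x => ?_
    rw [ENNReal.mul_rpow_of_nonneg _ _ hp0.le, ← ENNReal.rpow_mul, coe_singularWeight hα, mul_comm]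
    congr 2
    field_simp
  have e3 : ∫⁻ x in S, (singularSup x ^ (α / p)) ^ (p / (p - 1)) =
      ∫⁻ x in S, singularSup x ^ (α / (p - 1)) := by
    refine lintegral_congr fun x => ?_
    rw [← ENNReal.rpow_mul]
    congr 1
    field_simp
  simp only [Pi.mul_apply] at hH
  rw [e1, e2, e3] at hH
  refine (ENNReal.rpow_le_rpow hH hp0.le).trans (le_of_eq ?_)
  rw [ENNReal.mul_rpow_of_nonneg _ _ hp0.le, ← ENNReal.rpow_mul, ← ENNReal.rpow_mul]
  congr 2
  · rw [one_div_mul_cancel hp0.ne', ENNReal.rpow_one]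
  · field_simp

theorem div_sub_one_mem_Ioo (hα : 0 < α) (hp : 1 + α < p) :
    0 < α / (p - 1) ∧ α / (p - 1) < 1 :=
  ⟨div_pos hα (by linarith), (div_lt_one (by linarith)).2 (by linarith)⟩

/-- The pointwise form of the `A_p` condition: `w (⨍_B w ^ (1 / (1 - p))) ^ (p - 1) ≤ C` on `B`. -/
theorem exists_singularWeight_mul_rpow_le (n : ℕ) (hα : 0 < α) (hp : 1 + α < p) :
    ∃ C : ℝ≥0, ∀ (x : EuclideanSpace ℝ (Fin n)) (r : ℝ), 0 < r → ∀ z ∈ Metric.ball x r,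
      (singularWeight n α z : ℝ≥0∞) *
        (∫⁻ y in Metric.ball x r, singularSup y ^ (α / (p - 1))) ^ (p - 1) ≤
          C * volume (Metric.ball x r) ^ (p - 1) := by
  obtain ⟨hs0, hs1⟩ := div_sub_one_mem_Ioo hα hp
  have hp1 : 0 < p - 1 := by linarith
  obtain ⟨C, hC⟩ := exists_setLIntegral_singularSup_rpow_le_mul n hs0 hs1
  refine ⟨C ^ (p - 1), fun x r hr z hz => ?_⟩
  calc _ ≤ (singularWeight n α z : ℝ≥0∞) *
        (C * volume (Metric.ball x r) * singularSup z ^ (α / (p - 1))) ^ (p - 1) := by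
        gcongr
        exact hC x r hr z hz
    _ = (C : ℝ≥0∞) ^ (p - 1) * volume (Metric.ball x r) ^ (p - 1) *
        ((singularWeight n α z : ℝ≥0∞) * singularSup z ^ α) := by
        rw [ENNReal.mul_rpow_of_nonneg _ _ hp1.le, ENNReal.mul_rpow_of_nonneg _ _ hp1.le,
          ← ENNReal.rpow_mul, div_mul_cancel₀ _ hp1.ne']
        ring
    _ ≤ _ := by
        rw [ENNReal.coe_rpow_of_nonneg _ hp1.le]
        exact mul_le_of_le_one_right' (singularWeight_mul_le_one hα z)

theorem ENNReal.rpow_sub_one_mul_self {a : ℝ≥0∞} (h0 : a ≠ 0) (ht : a ≠ ∞) :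
    a ^ (p - 1) * a = a ^ p := by
  rw [ENNReal.rpow_sub _ _ h0 ht, ENNReal.rpow_one, ENNReal.div_mul_cancel h0 ht]

/-- The `A_p` condition, with `w ^ (1 / (1 - p)) = singularSup ^ (α / (p - 1))`. -/
theorem exists_singularMeasure_ball_mul_rpow_le (n : ℕ) (hα : 0 < α) (hp : 1 + α < p) :
    ∃ C : ℝ≥0, ∀ (x : EuclideanSpace ℝ (Fin n)) (r : ℝ), 0 < r →
      singularMeasure n α (Metric.ball x r) *
        (∫⁻ y in Metric.ball x r, singularSup y ^ (α / (p - 1))) ^ (p - 1) ≤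
          C * volume (Metric.ball x r) ^ p := by
  obtain ⟨C, hC⟩ := exists_singularWeight_mul_rpow_le n hα hp
  refine ⟨C, fun x r hr => ?_⟩
  rw [singularMeasure_apply measurableSet_ball,
    ← lintegral_mul_const _ measurable_singularWeight.coe_nnreal_ennreal]
  refine (setLIntegral_mono' measurableSet_ball (hC x r hr)).trans (le_of_eq ?_)
  rw [setLIntegral_const, mul_assoc,
    ENNReal.rpow_sub_one_mul_self (Metric.measure_ball_pos _ _ hr).ne' measure_ball_lt_top.ne]

theorem isMuckenhouptWeight_singularWeight (n : ℕ) (hα : 0 < α) (hp : 1 + α < p) :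
    IsMuckenhouptWeight p (singularWeight n α) := by
  obtain ⟨hs0, hs1⟩ := div_sub_one_mem_Ioo hα hp
  have hp1 : 0 < p - 1 := by linarith
  obtain ⟨C, hC⟩ := exists_singularMeasure_ball_mul_rpow_le n hα hp
  refine ⟨measurable_singularWeight, C, fun x r hr => ?_⟩
  have e : ∫⁻ y in Metric.ball x r, (singularWeight n α y : ℝ≥0∞) ^ (1 / (1 - p)) =
      ∫⁻ y in Metric.ball x r, singularSup y ^ (α / (p - 1)) := by
    refine lintegral_congr fun y => ?_
    rw [coe_singularWeight hα, ← ENNReal.rpow_mul]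
    congr 1
    rw [mul_one_div, ← neg_div_neg_eq, neg_neg, neg_sub]
  have hv0 : volume (Metric.ball x r) ≠ 0 := (Metric.measure_ball_pos _ _ hr).ne'
  have hvt : volume (Metric.ball x r) ≠ ∞ := measure_ball_lt_top.ne
  refine ⟨?_, ?_, ?_⟩
  · rw [← singularMeasure_apply measurableSet_ball]
    exact singularMeasure_ball_lt_top hα x r
  · rw [e]
    exact setLIntegral_singularSup_rpow_lt_top hs0 hs1 x hr
  · rw [setLAverage_eq, setLAverage_eq, e, ← singularMeasure_apply measurableSet_ball,
      ENNReal.div_rpow_of_nonneg _ _ hp1.le]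
    calc _ = singularMeasure n α (Metric.ball x r) *
          (∫⁻ y in Metric.ball x r, singularSup y ^ (α / (p - 1))) ^ (p - 1) *
            (volume (Metric.ball x r) ^ (p - 1) * volume (Metric.ball x r))⁻¹ := by
          rw [ENNReal.mul_inv (Or.inr hvt) (Or.inr hv0)]
          simp only [div_eq_mul_inv]
          ring
      _ ≤ C := by
          rw [ENNReal.rpow_sub_one_mul_self hv0 hvt, ← div_eq_mul_inv]
          exact ENNReal.div_le_of_le_mul (hC x r hr)

/-- The measure of a subset `S` of a ball `B` controls `w` everywhere on `B`. -/
theorem exists_singularWeight_mul_volume_rpow_le (n : ℕ) (hα : 0 < α) (hp : 1 + α < p) :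
    ∃ C : ℝ≥0, ∀ (x : EuclideanSpace ℝ (Fin n)) (r : ℝ), 0 < r → ∀ z ∈ Metric.ball x r,
      ∀ S ⊆ Metric.ball x r, MeasurableSet S →
        (singularWeight n α z : ℝ≥0∞) * volume S ^ p ≤
          C * volume (Metric.ball x r) ^ (p - 1) * singularMeasure n α S := by
  have hp1 : 0 < p - 1 := by linarith
  obtain ⟨C, hC⟩ := exists_singularWeight_mul_rpow_le n hα hp
  refine ⟨C, fun x r hr z hz S hS hSm => ?_⟩
  have h := setLIntegral_rpow_le_singularMeasure hα (by linarith : 1 < p) hSm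
    (g := fun _ => 1) measurable_const
  simp only [lintegral_const, one_mul, Measure.restrict_apply_univ, ENNReal.one_rpow] at h
  calc (singularWeight n α z : ℝ≥0∞) * volume S ^ p
      ≤ singularWeight n α z * (singularMeasure n α S *
          (∫⁻ y in Metric.ball x r, singularSup y ^ (α / (p - 1))) ^ (p - 1)) := by
        gcongr
        refine h.trans ?_
        gcongr
    _ = (singularWeight n α z *
          (∫⁻ y in Metric.ball x r, singularSup y ^ (α / (p - 1))) ^ (p - 1)) *
          singularMeasure n α S := by ring
    _ ≤ _ := by
        exact mul_le_mul_left (hC x r hr z hz) _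

/-- The supremum of `w` on a ball is comparable to its average. -/
theorem exists_singularWeight_mul_volume_le (n : ℕ) (hα : 0 < α) :
    ∃ C : ℝ≥0, ∀ (x : EuclideanSpace ℝ (Fin n)) (r : ℝ), 0 < r → ∀ z ∈ Metric.ball x r,
      (singularWeight n α z : ℝ≥0∞) * volume (Metric.ball x r) ≤
        C * singularMeasure n α (Metric.ball x r) := by
  obtain ⟨C, hC⟩ := exists_singularWeight_mul_volume_rpow_le n hα (lt_add_one (1 + α))
  refine ⟨C, fun x r hr z hz => ?_⟩
  have h := hC x r hr z hz _ Subset.rfl measurableSet_ball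
  have hv0 : volume (Metric.ball x r) ≠ 0 := (Metric.measure_ball_pos _ _ hr).ne'
  have hvt : volume (Metric.ball x r) ≠ ∞ := measure_ball_lt_top.ne
  have h0 : volume (Metric.ball x r) ^ (1 + α + 1 - 1) ≠ 0 := by
    simp [ENNReal.rpow_eq_zero_iff, hv0, hvt]
  have ht : volume (Metric.ball x r) ^ (1 + α + 1 - 1) ≠ ∞ :=
    ENNReal.rpow_ne_top_of_nonneg (by linarith) hvt
  rw [← ENNReal.rpow_sub_one_mul_self hv0 hvt] at h
  refine (ENNReal.mul_le_mul_iff_right h0 ht).1 ?_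
  calc _ = _ := mul_left_comm _ _ _
    _ ≤ _ := h
    _ = _ := by ring

theorem singularMeasure_ball_pos (hα : 0 < α) (x : EuclideanSpace ℝ (Fin n)) {r : ℝ} (hr : 0 < r) :
    0 < singularMeasure n α (Metric.ball x r) := by
  refine pos_iff_ne_zero.2 fun h0 => ?_
  have h := setLIntegral_rpow_le_singularMeasure (p := 2) hα one_lt_two
    (measurableSet_ball (x := x) (ε := r)) (g := fun _ => 1) measurable_const
  simp [h0, (Metric.measure_ball_pos volume x hr).ne'] at h

/-- The half-size ball is a large part of the ball in volume, and hence in measure. -/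
theorem isDoublingMeasure_singularMeasure (n : ℕ) (hα : 0 < α) :
    IsDoublingMeasure (singularMeasure n α) := by
  refine ⟨fun x r hr => ⟨singularMeasure_ball_pos hα x hr, singularMeasure_ball_lt_top hα x r⟩, ?_⟩
  have hp : 1 + α < 1 + α + 1 := lt_add_one _
  obtain ⟨C, hC⟩ := exists_singularWeight_mul_volume_rpow_le n hα hp
  have hp0 : 0 < 1 + α + 1 := by linarith
  have hp1 : 0 ≤ 1 + α + 1 - 1 := by linarith
  generalize 1 + α + 1 = p at *
  refine ⟨max 1 (C * (2 ^ n) ^ p), le_max_left _ _, fun x r hr => ?_⟩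
  have hv0 : volume (Metric.ball x r) ≠ 0 := (Metric.measure_ball_pos _ _ hr).ne'
  have hvt : volume (Metric.ball x r) ≠ ∞ := measure_ball_lt_top.ne
  have hv2 : volume (Metric.ball x (2 * r)) = 2 ^ n * volume (Metric.ball x r) := by
    rw [Measure.addHaar_ball_mul_of_pos _ _ two_pos, finrank_euclideanSpace, Fintype.card_fin,
      ← Measure.addHaar_ball_center volume x, ENNReal.ofReal_pow zero_le_two, ENNReal.ofReal_ofNat]
  have h20 : volume (Metric.ball x (2 * r)) ≠ 0 := (Metric.measure_ball_pos _ _ (by linarith)).ne'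
  have h2t : volume (Metric.ball x (2 * r)) ≠ ∞ := measure_ball_lt_top.ne
  have h : singularMeasure n α (Metric.ball x (2 * r)) * volume (Metric.ball x r) ^ p ≤
      (C * (2 ^ n) ^ p * singularMeasure n α (Metric.ball x r)) * volume (Metric.ball x r) ^ p := by
    rw [singularMeasure_apply (measurableSet_ball (x := x) (ε := 2 * r)),
      ← lintegral_mul_const _ measurable_singularWeight.coe_nnreal_ennreal]
    calc _ ≤ ∫⁻ _z in Metric.ball x (2 * r), C * volume (Metric.ball x (2 * r)) ^ (p - 1) *
          singularMeasure n α (Metric.ball x r) :=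
          setLIntegral_mono' measurableSet_ball fun z hz => hC x (2 * r) (by linarith) z hz _
            (Metric.ball_subset_ball (by linarith)) measurableSet_ball
      _ = C * (volume (Metric.ball x (2 * r)) ^ (p - 1) * volume (Metric.ball x (2 * r))) *
          singularMeasure n α (Metric.ball x r) := by
          rw [setLIntegral_const]
          ring
      _ = _ := by
          rw [ENNReal.rpow_sub_one_mul_self h20 h2t, hv2, ENNReal.mul_rpow_of_nonneg _ _ hp0.le]
          ring
  rw [ENNReal.mul_le_mul_iff_left (by simp [ENNReal.rpow_eq_zero_iff, hv0, hvt])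
    (ENNReal.rpow_ne_top_of_nonneg hp0.le hvt)] at h
  refine h.trans ?_
  gcongr
  rw [ENNReal.coe_max, ENNReal.coe_mul, ENNReal.coe_rpow_of_nonneg _ hp0.le]
  simp

/-- On a ball `w` is at most a constant times its average, so that the mean oscillation for `μ` is
at most a constant times that for the Lebesgue measure. The latter is bounded by the Lebesgue
average of the slope, and Hölder's inequality with the `A_p` condition passes to the `μ`-average
of its `p`-th power. The dilation factor `2` only serves to make `f` Lipschitz and bounded on `B`. -/
theorem weakPoincare_singularMeasure (n : ℕ) (hα : 0 < α) (hp : 1 + α < p) :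
    WeakPoincare (singularMeasure n α) p := by
  have hp0 : 0 < p := by linarith
  obtain ⟨C₁, hC₁⟩ := exists_singularWeight_mul_volume_le n hα
  obtain ⟨C₂, hC₂⟩ := exists_singularMeasure_ball_mul_rpow_le n hα hp
  obtain ⟨-, C₃, -, hC₃⟩ := isDoublingMeasure_singularMeasure n hα
  refine ⟨C₁ ^ 2 * 2 ^ n * 2 * (C₂ * C₃) ^ (1 / p), 2, one_le_two, fun x r hr f hf => ?_⟩
  set μ := singularMeasure n α with hμ
  set B := Metric.ball x r with hB
  -- Only the values of `f` near the closed ball `B(x, 3r/2)` matter, and there `f` is Lipschitz.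
  obtain ⟨K, hK⟩ : ∃ K, LipschitzOnWith K f (Metric.closedBall x (3 / 2 * r)) :=
    (hf.mono (Metric.closedBall_subset_ball (by linarith))).exists_lipschitzOnWith_of_compact
      (isCompact_closedBall _ _)
  obtain ⟨F, hF, hfF⟩ := hK.extend_real
  have hBF : ∀ y ∈ B, f y = F y := fun y hy =>
    hfF (Metric.ball_subset_closedBall (Metric.ball_subset_ball (by linarith) hy))
  have hslope : ∀ y ∈ B, localSlope f y = localSlope F y := fun y hy =>
    localSlope_congr (by
      filter_upwards [Metric.isOpen_ball.mem_nhds hy] with z hz using hBF z hz)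
  have hFm := measurable_localSlope hF.continuous
  have hv0 : volume B ≠ 0 := (Metric.measure_ball_pos _ _ hr).ne'
  have hvt : volume B ≠ ∞ := measure_ball_lt_top.ne
  have hμ0 : μ B ≠ 0 := (singularMeasure_ball_pos hα x hr).ne'
  have hμt : μ B ≠ ∞ := (singularMeasure_ball_lt_top hα x r).ne
  have hle : μ.restrict B ≤ (C₁ * μ B / volume B) • volume.restrict B := by
    refine Measure.le_iff.2 fun S hS => ?_
    rw [Measure.restrict_apply hS, hμ, singularMeasure_apply (hS.inter measurableSet_ball),
      Measure.smul_apply, Measure.restrict_apply hS, smul_eq_mul, ← setLIntegral_const]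
    refine setLIntegral_mono' (hS.inter measurableSet_ball) fun z hz => ?_
    rw [ENNReal.le_div_iff_mul_le (Or.inl hv0) (Or.inl hvt)]
    exact hC₁ x r hr z hz.2
  have hFint : IntegrableOn F B μ := by
    have := isFiniteMeasure_restrict.2 hμt
    refine (Measure.integrableOn_of_bounded (M := ‖F x‖ + K * r) hμt
      hF.continuous.aestronglyMeasurable ?_)
    refine (ae_restrict_iff' measurableSet_ball).2 (Eventually.of_forall fun y hy => ?_)
    have h1 : dist (F y) (F x) ≤ K * dist y x := hF.dist_le_mul y x
    have h2 : dist y x ≤ r := le_of_lt hy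
    have h3 : ‖F y‖ ≤ ‖F x‖ + dist (F y) (F x) := by
      rw [dist_eq_norm]
      exact norm_le_norm_add_norm_sub' (F y) (F x)
    have h4 : (K : ℝ) * dist y x ≤ K * r := by gcongr
    linarith
  -- The Lebesgue Poincaré inequality bounds the mean oscillation with respect to `μ`.
  have hosc : ⨍⁻ y in B, edist (F y) (⨍ z in B, F z ∂μ) ∂μ ≤
      C₁ ^ 2 * 2 ^ n * (2 * ENNReal.ofReal r) * ((∫⁻ z in B, localSlope F z) / volume B) := by
    calc ⨍⁻ y in B, edist (F y) (⨍ z in B, F z ∂μ) ∂μ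
        ≤ (∫⁻ y in B, (∫⁻ z in B, edist (F y) (F z) ∂μ) / μ B ∂μ) / μ B := by
          rw [setLAverage_eq]
          gcongr with y
          rw [← setLAverage_eq]
          exact edist_setAverage_le hFint hμ0 hμt _
      _ ≤ ((C₁ * μ B / volume B) * ∫⁻ y in B,
            ((C₁ * μ B / volume B) * ∫⁻ z in B, edist (F y) (F z)) / μ B) / μ B := by
          gcongr
          refine (lintegral_mono' hle le_rfl).trans ?_
          rw [lintegral_smul_measure, smul_eq_mul]
          gcongr with y
          refine (lintegral_mono' hle le_rfl).trans ?_
          rw [lintegral_smul_measure, smul_eq_mul]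
      _ = ((C₁ * μ B / volume B) * (((C₁ * μ B / volume B) * ∫⁻ y in B,
            ∫⁻ z in B, edist (F y) (F z)) / μ B)) / μ B := by
          have hm : Measurable fun y => ∫⁻ z in B, edist (F y) (F z) := by
            have : Measurable (Function.uncurry fun y z => edist (F y) (F z)) := by
              have := hF.continuous
              apply Continuous.measurable
              simp only [Function.uncurry_def]
              fun_prop
            exact this.lintegral_prod_right'
          simp only [div_eq_mul_inv]
          rw [lintegral_mul_const _ (hm.const_mul _), lintegral_const_mul _ hm]
      _ ≤ ((C₁ * μ B / volume B) * (((C₁ * μ B / volume B) * (2 ^ n * (2 * ENNReal.ofReal r) *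
            volume B * ∫⁻ z in B, localSlope F z)) / μ B)) / μ B := by
          gcongr
          have h := lintegral_lintegral_edist_le volume (convex_ball x r) measurableSet_ball hF
            (d := 2 * ENNReal.ofReal r) (fun y hy z hz => ?_)
          · simpa only [finrank_euclideanSpace, Fintype.card_fin] using h
          · have h2r : 2 * ENNReal.ofReal r = ENNReal.ofReal (2 * r) := by
              rw [ENNReal.ofReal_mul zero_le_two, ENNReal.ofReal_ofNat]
            rw [← edist_eq_enorm_sub, edist_dist, h2r]
            refine ENNReal.ofReal_le_ofReal ?_
            have h1 := dist_triangle_right z y x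
            have h2 : dist y x < r := hy
            have h3 : dist z x < r := hz
            linarith
      _ = (μ B * (μ B)⁻¹) * (μ B * (μ B)⁻¹) * (volume B * (volume B)⁻¹) * (C₁ ^ 2 * 2 ^ n *
            (2 * ENNReal.ofReal r) * ((∫⁻ z in B, localSlope F z) / volume B)) := by
          simp only [div_eq_mul_inv]
          ring
      _ = _ := by
          rw [ENNReal.mul_inv_cancel hμ0 hμt, ENNReal.mul_inv_cancel hv0 hvt]
          simp
  -- Hölder's inequality and the `A_p` condition pass to the mean of the `p`-th power.
  have hmean : (∫⁻ z in B, localSlope F z) / volume B ≤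
      (C₂ * ((∫⁻ z in B, localSlope F z ^ p ∂μ) / μ B)) ^ (1 / p) := by
    rw [one_div, ENNReal.le_rpow_inv_iff hp0, ENNReal.div_rpow_of_nonneg _ _ hp0.le]
    refine ENNReal.div_le_of_le_mul ((setLIntegral_rpow_le_singularMeasure hα (by linarith)
      measurableSet_ball hFm).trans ?_)
    calc (∫⁻ z in B, localSlope F z ^ p ∂μ) *
          (∫⁻ y in B, singularSup y ^ (α / (p - 1))) ^ (p - 1)
        ≤ (∫⁻ z in B, localSlope F z ^ p ∂μ) * (C₂ * volume B ^ p / μ B) := by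
          gcongr
          rw [ENNReal.le_div_iff_mul_le (Or.inl hμ0) (Or.inl hμt), mul_comm]
          exact hC₂ x r hr
      _ = _ := by
          simp only [div_eq_mul_inv]
          ring
  have hbig : (∫⁻ z in B, localSlope F z ^ p ∂μ) / μ B ≤
      C₃ * ⨍⁻ y in Metric.ball x (2 * r), localSlope f y ^ p ∂μ := by
    have h20 : μ (Metric.ball x (2 * r)) ≠ 0 := (singularMeasure_ball_pos hα x (by linarith)).ne'
    have h2t : μ (Metric.ball x (2 * r)) ≠ ∞ := (singularMeasure_ball_lt_top hα x _).ne
    rw [setLAverage_eq]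
    calc (∫⁻ z in B, localSlope F z ^ p ∂μ) / μ B
        = (∫⁻ z in B, localSlope f z ^ p ∂μ) / μ B := by
          congr 1
          exact setLIntegral_congr_fun measurableSet_ball fun z hz => by simp only [hslope z hz]
      _ ≤ (∫⁻ z in Metric.ball x (2 * r), localSlope f z ^ p ∂μ) *
            (C₃ / μ (Metric.ball x (2 * r))) := by
          rw [div_eq_mul_inv]
          refine mul_le_mul' (lintegral_mono_set (Metric.ball_subset_ball (by linarith))) ?_
          rw [ENNReal.le_div_iff_mul_le (Or.inl h20) (Or.inl h2t), mul_comm, ← div_eq_mul_inv]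
          exact ENNReal.div_le_of_le_mul (hC₃ x r hr)
      _ = _ := by
          simp only [div_eq_mul_inv]
          ring
  have hLHS : ⨍⁻ y in B, edist (f y) (⨍ z in B, f z ∂μ) ∂μ =
      ⨍⁻ y in B, edist (F y) (⨍ z in B, F z ∂μ) ∂μ := by
    have h1 : ⨍ z in B, f z ∂μ = ⨍ z in B, F z ∂μ := by
      rw [setAverage_eq, setAverage_eq, setIntegral_congr_fun measurableSet_ball hBF]
    rw [h1, setLAverage_eq, setLAverage_eq]
    congr 1
    exact setLIntegral_congr_fun measurableSet_ball fun y hy => by simp only [hBF y hy]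
  rw [hLHS]
  refine hosc.trans ((mul_le_mul_right hmean _).trans ?_)
  calc _ ≤ C₁ ^ 2 * 2 ^ n * (2 * ENNReal.ofReal r) *
        (C₂ * (C₃ * ⨍⁻ y in Metric.ball x (2 * r), localSlope f y ^ p ∂μ)) ^ (1 / p) := by
        gcongr
    _ = _ := by
        rw [← mul_assoc (C₂ : ℝ≥0∞), ENNReal.mul_rpow_of_nonneg _ _ (by positivity)]
        push_cast
        rw [ENNReal.coe_rpow_of_nonneg _ (by positivity : 0 ≤ 1 / p)]
        push_cast
        ring

end MuckenhouptWeight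


/-! ### Integrability along translates of a segment -/

section LocalIntegrability

theorem IsLocallyPIntegrable.setLIntegral_lt_top {X : Type*} [MetricSpace X] [MeasurableSpace X]
    {m : Measure X} {p : ℝ} {g : X → ℝ≥0∞} (hg : IsLocallyPIntegrable m p g) {S : Set X}
    (hS : IsCompact S) : ∫⁻ x in S, g x ^ p ∂m < ∞ := by
  refine hS.induction_on (p := fun S => ∫⁻ x in S, g x ^ p ∂m < ∞) (by simp)
    (fun s t hst ht => (lintegral_mono_set hst).trans_lt ht)
    (fun s t hs ht => (lintegral_union_le _ _ _).trans_lt (ENNReal.add_lt_top.2 ⟨hs, ht⟩))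
    fun x _ => ?_
  obtain ⟨U, hU, hU'⟩ := hg x
  exact ⟨U, mem_nhdsWithin_of_mem_nhds hU, hU'⟩

variable {E : Type*} [NormedAddCommGroup E] [NormedSpace ℝ E] [FiniteDimensional ℝ E]
  [MeasurableSpace E] [BorelSpace E] {ν : Measure E} [ν.IsAddHaarMeasure]

theorem measurable_segment_uncurry (v : E) {g : E → ℝ≥0∞} (hg : Measurable g) :
    Measurable (Function.uncurry fun (x : E) (r : ℝ) => g (x + r • v)) := by
  have : Measurable fun z : E × ℝ => z.1 + z.2 • v := by fun_prop
  exact hg.comp this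

/-- A locally integrable function is integrable along almost every translate of a segment. -/
theorem ae_lintegral_segment_lt_top {g : E → ℝ≥0∞} (hg : Measurable g)
    (hloc : ∀ R : ℝ, ∫⁻ x in Metric.ball 0 R, g x ∂ν < ∞) (v : E) :
    ∀ᵐ x ∂ν, ∫⁻ r in Icc (0 : ℝ) 1, g (x + r • v) < ∞ := by
  have hm := measurable_segment_uncurry v hg
  have h : ∀ k : ℕ, ∀ᵐ x ∂ν, x ∈ Metric.ball (0 : E) k →
      ∫⁻ r in Icc (0 : ℝ) 1, g (x + r • v) < ∞ := by
    intro k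
    rw [← ae_restrict_iff' measurableSet_ball]
    refine ae_lt_top hm.lintegral_prod_right' (ne_of_lt ?_)
    calc ∫⁻ x in Metric.ball (0 : E) k, (∫⁻ r in Icc (0 : ℝ) 1, g (x + r • v)) ∂ν
        = ∫⁻ r in Icc (0 : ℝ) 1, (∫⁻ x in Metric.ball (0 : E) k, g (x + r • v) ∂ν) :=
          lintegral_lintegral_swap hm.aemeasurable
      _ ≤ ∫⁻ _r in Icc (0 : ℝ) 1, (∫⁻ x in Metric.ball (0 : E) (k + ‖v‖), g x ∂ν) := by
          refine setLIntegral_mono' measurableSet_Icc fun r hr => ?_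
          rw [← lintegral_indicator (measurableSet_ball (x := (0 : E)) (ε := k + ‖v‖)),
            ← lintegral_add_right_eq_self (μ := ν) _ (r • v)]
          refine (setLIntegral_mono' measurableSet_ball fun x hx => ?_).trans
            (setLIntegral_le_lintegral _ _)
          rw [indicator_of_mem]
          rw [mem_ball_zero_iff] at hx ⊢
          have h1 : ‖r • v‖ ≤ ‖v‖ := by
            rw [norm_smul, Real.norm_of_nonneg hr.1]
            exact mul_le_of_le_one_left (norm_nonneg v) hr.2
          linarith [norm_add_le x (r • v)]
      _ < ∞ := by simpa using hloc _
  filter_upwards [ae_all_iff.2 h] with x hx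
  obtain ⟨k, hk⟩ := exists_nat_gt ‖x‖
  exact hx k (by simpa using hk)

/-- A set that almost every translate of a segment meets in a null set is null. -/
theorem measure_eq_zero_of_ae_segment {S : Set E} (hS : MeasurableSet S) (v : E)
    (h : ∀ᵐ x ∂ν, ∀ᵐ r : ℝ, r ∈ Icc (0 : ℝ) 1 → x + r • v ∉ S) : ν S = 0 := by
  have hm := measurable_segment_uncurry v
    ((measurable_const (a := (1 : ℝ≥0∞))).indicator hS)
  have h1 : ∫⁻ x,
      (∫⁻ r in Icc (0 : ℝ) 1, S.indicator (fun _ => (1 : ℝ≥0∞)) (x + r • v)) ∂ν = 0 := by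
    rw [← lintegral_zero (α := E) (μ := ν)]
    refine lintegral_congr_ae ?_
    filter_upwards [h] with x hx
    rw [← lintegral_zero (α := ℝ) (μ := volume.restrict (Icc (0 : ℝ) 1))]
    refine lintegral_congr_ae ((ae_restrict_iff' measurableSet_Icc).2 ?_)
    filter_upwards [hx] with r hr hrI
    exact indicator_of_notMem (hr hrI) _
  rw [lintegral_lintegral_swap hm.aemeasurable] at h1
  have h2 : ∀ r : ℝ, ∫⁻ x, S.indicator (fun _ => (1 : ℝ≥0∞)) (x + r • v) ∂ν = ν S := by
    intro r
    rw [lintegral_add_right_eq_self (μ := ν) (S.indicator fun _ => (1 : ℝ≥0∞)) (r • v),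
      lintegral_indicator hS, setLIntegral_one]
  simpa [h2] using h1

end LocalIntegrability

/-! ### The weak gradient for `p > 1 + α` -/

section WeakGradient

variable {n : ℕ} {α p : ℝ}

/-- Locally `p`-integrable functions with respect to `μ` are locally Lebesgue integrable. -/
theorem setLIntegral_ball_le_of_singularMeasure (hα : 0 < α) (hp : 1 + α < p)
    {g : EuclideanSpace ℝ (Fin n) → ℝ≥0∞} (hg : Measurable g) (x : EuclideanSpace ℝ (Fin n))
    (R : ℝ) :
    ∫⁻ y in Metric.ball x R, g y ≤ (∫⁻ y in Metric.ball x R, g y ^ p ∂(singularMeasure n α)) ^ p⁻¹ *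
      ((∫⁻ y in Metric.ball x R, singularSup y ^ (α / (p - 1))) ^ (p - 1)) ^ p⁻¹ := by
  have hp0 : 0 < p := by linarith
  rw [← ENNReal.mul_rpow_of_nonneg _ _ (inv_nonneg.2 hp0.le), ENNReal.le_rpow_inv_iff hp0]
  exact setLIntegral_rpow_le_singularMeasure hα (by linarith) measurableSet_ball hg

theorem singularSup_rpow_rpow_ne_top (hα : 0 < α) (hp : 1 + α < p)
    (x : EuclideanSpace ℝ (Fin n)) (R : ℝ) :
    ((∫⁻ y in Metric.ball x R, singularSup y ^ (α / (p - 1))) ^ (p - 1)) ^ p⁻¹ ≠ ∞ := by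
  obtain ⟨hs0, hs1⟩ := div_sub_one_mem_Ioo hα hp
  have h : ∫⁻ y in Metric.ball x R, singularSup y ^ (α / (p - 1)) < ∞ := by
    refine (lintegral_mono_set (Metric.ball_subset_ball (le_max_left R 1))).trans_lt
      (setLIntegral_singularSup_rpow_lt_top hs0 hs1 x (by positivity))
  exact ENNReal.rpow_ne_top_of_nonneg (inv_nonneg.2 (by linarith))
    (ENNReal.rpow_ne_top_of_nonneg (by linarith) h.ne)

/-- A family of curves of `p`-modulus zero misses all subsegments of almost every translate of a
given segment. -/
theorem ae_segment_notMem_of_pModulus_eq_zero (hα : 0 < α) (hp : 1 + α < p)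
    {Γ : Set (ACCurve (EuclideanSpace ℝ (Fin n)))} (hΓ : pModulus (singularMeasure n α) p Γ = 0)
    (v : EuclideanSpace ℝ (Fin n)) :
    ∀ᵐ x : EuclideanSpace ℝ (Fin n), ∀ (s t : ℝ) (hst : s ≤ t), 0 ≤ s → t ≤ 1 →
      ACCurve.segment x v hst ∉ Γ := by
  have hp0 : 0 < p := by linarith
  have hex : ∀ k : ℕ, ∃ g : EuclideanSpace ℝ (Fin n) → ℝ≥0∞, Measurable g ∧
      (∀ γ ∈ Γ, 1 ≤ γ.lineIntegral g) ∧
        ∫⁻ x, g x ^ p ∂(singularMeasure n α) < ((2⁻¹ : ℝ≥0∞) ^ k) ^ p := fun k =>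
    exists_of_pModulus_lt (by
      rw [hΓ]
      exact ENNReal.rpow_pos (ENNReal.pow_pos (by simp) k) (ENNReal.pow_ne_top (by simp)))
  -- The sum of the test functions is locally integrable, so that their integrals over almost every
  -- segment tend to `0`, while those over a curve in `Γ` are at least `1`.
  choose g hgm hgΓ hgint using hex
  have hGm : Measurable fun x => ∑' k, g k x := Measurable.tsum hgm
  have hloc : ∀ R : ℝ, ∫⁻ x in Metric.ball 0 R, ∑' k, g k x < ∞ := by
    intro R
    rw [lintegral_tsum fun k => (hgm k).aemeasurable]
    set T := ((∫⁻ y in Metric.ball (0 : EuclideanSpace ℝ (Fin n)) R,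
      singularSup y ^ (α / (p - 1))) ^ (p - 1)) ^ p⁻¹ with hT
    calc ∑' k, ∫⁻ x in Metric.ball 0 R, g k x ≤ ∑' k : ℕ, (2⁻¹ : ℝ≥0∞) ^ k * T := by
          refine ENNReal.tsum_le_tsum fun k => ?_
          refine (setLIntegral_ball_le_of_singularMeasure hα hp (hgm k) 0 R).trans ?_
          gcongr
          rw [ENNReal.rpow_inv_le_iff hp0]
          exact (setLIntegral_le_lintegral _ _).trans (hgint k).le
      _ = 2 * T := by rw [ENNReal.tsum_mul_right, ENNReal.tsum_geometric_two]
      _ < ∞ := ENNReal.mul_lt_top (by simp) (singularSup_rpow_rpow_ne_top hα hp 0 R).lt_top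
  filter_upwards [ae_lintegral_segment_lt_top hGm hloc v] with x hx s t hst hs ht hmem
  have hseg : ∀ k, Measurable fun r : ℝ => g k (x + r • v) := fun k =>
    (hgm k).comp (by fun_prop)
  rw [lintegral_tsum fun k => (hseg k).aemeasurable] at hx
  have hlim := ENNReal.tendsto_atTop_zero_of_tsum_ne_top hx.ne
  have hlim' := ENNReal.Tendsto.mul_const (b := ‖v‖ₑ) hlim (Or.inr enorm_ne_top)
  rw [zero_mul] at hlim'
  obtain ⟨k, hk⟩ := (hlim'.eventually_lt_const zero_lt_one).exists
  refine absurd (hgΓ k _ hmem) (not_le.2 ?_)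
  refine lt_of_le_of_lt ?_ hk
  refine (ACCurve.lineIntegral_segment_le x v hst _).trans ?_
  rw [lintegral_mul_const _ (hseg k)]
  gcongr

/-- A `p`-upper gradient bounds the directional derivatives almost everywhere: on almost every
line in the direction `v` it is an upper gradient along all short segments, so that Lebesgue's
differentiation theorem applies. -/
theorem ae_enorm_fderiv_apply_le (hα : 0 < α) (hp : 1 + α < p)
    {f : EuclideanSpace ℝ (Fin n) → ℝ} {K : ℝ≥0} (hf : LipschitzWith K f)
    {h : EuclideanSpace ℝ (Fin n) → ℝ≥0∞} (hug : IsPUpperGradient (singularMeasure n α) p f h)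
    (hint : IsLocallyPIntegrable (singularMeasure n α) p h) (v : EuclideanSpace ℝ (Fin n)) :
    ∀ᵐ x : EuclideanSpace ℝ (Fin n), DifferentiableAt ℝ f x →
      ‖fderiv ℝ f x v‖ₑ ≤ h x * ‖v‖ₑ := by
  have hp0 : 0 < p := by linarith
  obtain ⟨hm, hmod⟩ := hug
  have hloc : ∀ R : ℝ, ∫⁻ x in Metric.ball 0 R, h x < ∞ := fun R => by
    refine (setLIntegral_ball_le_of_singularMeasure hα hp hm 0 R).trans_lt (ENNReal.mul_lt_top
      (ENNReal.rpow_lt_top_of_nonneg (inv_nonneg.2 hp0.le) (ne_of_lt ?_))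
      (singularSup_rpow_rpow_ne_top hα hp 0 R).lt_top)
    exact (lintegral_mono_set Metric.ball_subset_closedBall).trans_lt
      (hint.setLIntegral_lt_top (isCompact_closedBall _ _))
  set S := {x | DifferentiableAt ℝ f x} ∩ {x | h x * ‖v‖ₑ < ‖fderiv ℝ f x v‖ₑ} with hS
  have hSm : MeasurableSet S := (measurableSet_of_differentiableAt ℝ f).inter
    (measurableSet_lt (hm.mul_const _) (measurable_fderiv_apply_const ℝ f v).enorm)
  suffices volume S = 0 by
    have h1 : ∀ᵐ x : EuclideanSpace ℝ (Fin n), x ∉ S := measure_eq_zero_iff_ae_notMem.1 this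
    filter_upwards [h1] with x hx hdiff
    by_contra hcon
    exact hx ⟨hdiff, not_le.1 hcon⟩
  refine measure_eq_zero_of_ae_segment hSm v ?_
  filter_upwards [ae_lintegral_segment_lt_top hm hloc v,
    ae_segment_notMem_of_pModulus_eq_zero hα hp hmod v] with x hx hxΓ
  set γ : ACCurve ℝ := (ACCurve.segment x v zero_le_one).compLipschitz f hf with hγ
  have hHm : Measurable fun r : ℝ => h (x + r • v) * ‖v‖ₑ :=
    (hm.comp (by fun_prop : Measurable fun r : ℝ => x + r • v)).mul_const _
  have hHint : ∫⁻ r in Icc (0 : ℝ) 1, h (x + r • v) * ‖v‖ₑ ≠ ∞ := by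
    rw [lintegral_mul_const (f := fun r : ℝ => h (x + r • v)) _
      (hm.comp (by fun_prop : Measurable fun r : ℝ => x + r • v))]
    exact ENNReal.mul_ne_top hx.ne enorm_ne_top
  have hbound : ∀ s ∈ Icc γ.a γ.b, ∀ t ∈ Icc γ.a γ.b, s ≤ t →
      dist (γ.toFun s) (γ.toFun t) ≤ ∫ r in s..t, (h (x + r • v) * ‖v‖ₑ).toReal := by
    intro s hs t ht hst
    have hsub : Icc s t ⊆ Icc (0 : ℝ) 1 := Icc_subset_Icc hs.1 ht.2
    have hfin : ∫⁻ r in Ioc s t, h (x + r • v) * ‖v‖ₑ ≠ ∞ :=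
      ((lintegral_mono_set (Ioc_subset_Icc_self.trans hsub)).trans_lt hHint.lt_top).ne
    have h1 : edist (f (x + t • v)) (f (x + s • v)) ≤ ∫⁻ r in Icc s t, h (x + r • v) * ‖v‖ₑ := by
      exact (not_not.1 (hxΓ s t hst hs.1 ht.2)).trans (ACCurve.lineIntegral_segment_le x v hst h)
    rw [intervalIntegral.integral_of_le hst, integral_toReal hHm.aemeasurable
      (ae_lt_top hHm hfin), ← ENNReal.ofReal_le_iff_le_toReal hfin, ← edist_dist, edist_comm]
    refine h1.trans (le_of_eq ?_)
    rw [Measure.restrict_congr_set Ioc_ae_eq_Icc]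
  filter_upwards [γ.metricSpeed_le (integrable_toReal_of_lintegral_ne_top hHm.aemeasurable hHint)
    hbound, compl_mem_ae_iff.2 (measure_singleton (0 : ℝ)),
    compl_mem_ae_iff.2 (measure_singleton (1 : ℝ))] with r hr hr0 hr1 hrI hrS
  have hrIoo : r ∈ Ioo γ.a γ.b := ⟨lt_of_le_of_ne hrI.1 (Ne.symm hr0), lt_of_le_of_ne hrI.2 hr1⟩
  have hderiv : HasDerivAt γ.toFun (fderiv ℝ f (x + r • v) v) r := by
    have h1 : HasDerivAt (fun r : ℝ => x + r • v) v r := by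
      simpa using ((hasDerivAt_id r).smul_const v).const_add x
    exact hrS.1.hasFDerivAt.comp_hasDerivAt r h1
  exact absurd ((γ.enorm_le_metricSpeed_of_hasDerivAt hrIoo hderiv).trans
    ((hr hrI).trans ENNReal.ofReal_toReal_le)) (not_le.2 hrS.2)

theorem singularMeasure_absolutelyContinuous : singularMeasure n α ≪ volume :=
  withDensity_absolutelyContinuous _ _

/-- The slope is an upper gradient along every curve, and the minimal one because every other one
bounds all directional derivatives. -/
theorem isPWeakGradient_localSlope (hα : 0 < α) (hp : 1 + α < p)
    {f : EuclideanSpace ℝ (Fin n) → ℝ} {K : ℝ≥0} (hf : LipschitzWith K f) :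
    IsPWeakGradient (singularMeasure n α) p f (localSlope f) := by
  have hp0 : 0 < p := by linarith
  refine ⟨⟨measurable_localSlope hf.continuous, ?_⟩, fun x => ?_, fun h hug hint => ?_⟩
  · convert pModulus_empty (m := singularMeasure n α)
      (X := EuclideanSpace ℝ (Fin n)) hp0 using 2
    refine eq_empty_of_forall_notMem fun γ hγ => hγ ?_
    exact γ.edist_le_lineIntegral_localSlope hf (right_mem_Icc.2 γ.a_le_b) (left_mem_Icc.2 γ.a_le_b)
  · refine ⟨_, Metric.ball_mem_nhds x one_pos, ?_⟩
    calc ∫⁻ y in Metric.ball x 1, localSlope f y ^ p ∂(singularMeasure n α)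
        ≤ ∫⁻ _y in Metric.ball x 1, (K : ℝ≥0∞) ^ p ∂(singularMeasure n α) := by
          gcongr with y
          exact hf.localSlope_le y
      _ < ∞ := by
          rw [setLIntegral_const]
          exact ENNReal.mul_lt_top (ENNReal.rpow_lt_top_of_nonneg hp0.le (by simp))
            (singularMeasure_ball_lt_top hα x 1)
  -- By Rademacher's theorem the slope is almost everywhere the norm of the derivative, and this
  -- norm is determined by countably many directions.
  · refine singularMeasure_absolutelyContinuous.ae_le ?_
    have hdir := ae_all_iff.2 fun k : ℕ => ae_enorm_fderiv_apply_le hα hp hf hug hint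
      (TopologicalSpace.denseSeq (EuclideanSpace ℝ (Fin n)) k)
    filter_upwards [hdir, hf.ae_differentiableAt (μ := volume)] with x hx hdiff
    rcases eq_top_or_lt_top (h x) with htop | hfin
    · rw [htop]
      exact le_top
    refine (localSlope_le_enorm_fderiv hdiff).trans ?_
    have hall : ∀ v, ‖fderiv ℝ f x v‖ ≤ (h x).toReal * ‖v‖ := by
      intro v
      refine (TopologicalSpace.denseRange_denseSeq _).induction_on
        (p := fun v => ‖fderiv ℝ f x v‖ ≤ (h x).toReal * ‖v‖) v
        (isClosed_le (by fun_prop) (by fun_prop)) fun k => ?_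
      have h1 := ENNReal.toReal_mono (ENNReal.mul_ne_top hfin.ne enorm_ne_top) (hx k hdiff)
      simpa [ENNReal.toReal_mul] using h1
    rw [← ofReal_norm, ← ENNReal.ofReal_toReal hfin.ne]
    exact ENNReal.ofReal_le_ofReal
      (ContinuousLinearMap.opNorm_le_bound _ ENNReal.toReal_nonneg hall)

end WeakGradient


/-! ### The modulus of a bounded family for different exponents -/

section BoundedFamilies

variable {X : Type*} [MetricSpace X] [MeasurableSpace X] {m : Measure X}

theorem pModulus_le_setLIntegral {p : ℝ} (hp : 0 < p) {Γ : Set (ACCurve X)} {S : Set X}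
    (hS : MeasurableSet S) (hΓ : ∀ γ ∈ Γ, ∀ t ∈ Icc γ.a γ.b, γ.toFun t ∈ S) {g : X → ℝ≥0∞}
    (hg : Measurable g) (h : ∀ γ ∈ Γ, 1 ≤ γ.lineIntegral g) :
    pModulus m p Γ ≤ ∫⁻ x in S, g x ^ p ∂m := by
  refine (pModulus_le (hg.indicator hS) fun γ hγ => (h γ hγ).trans (le_of_eq ?_)).trans
    (le_of_eq ?_)
  · exact setLIntegral_congr_fun measurableSet_Icc fun t ht => by
      simp only [indicator_of_mem (hΓ γ hγ t ht)]
  · rw [← lintegral_indicator hS]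
    refine lintegral_congr fun x => ?_
    by_cases hx : x ∈ S
    · simp [hx]
    · simp [hx, hp]

/-- For curves in a set of finite measure, Hölder's inequality compares the moduli for different
exponents. -/
theorem pModulus_eq_zero_of_le {p p' : ℝ} (hp : 0 < p) (hpp' : p ≤ p') {Γ : Set (ACCurve X)}
    {S : Set X} (hS : MeasurableSet S) (hSt : m S ≠ ∞)
    (hΓ : ∀ γ ∈ Γ, ∀ t ∈ Icc γ.a γ.b, γ.toFun t ∈ S) (h : pModulus m p' Γ = 0) :
    pModulus m p Γ = 0 := by
  have hp' : 0 < p' := hp.trans_le hpp'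
  have hexp : 0 ≤ 1 / p - 1 / p' := sub_nonneg.2 (one_div_le_one_div_of_le hp hpp')
  have key : ∀ c : ℝ≥0∞, 0 < c →
      pModulus m p Γ ≤ (c ^ (1 / p') * m S ^ (1 / p - 1 / p')) ^ p := by
    intro c hc
    obtain ⟨g, hg, hgΓ, hgint⟩ := exists_of_pModulus_lt (h.trans_lt hc)
    refine (pModulus_le_setLIntegral hp hS hΓ hg hgΓ).trans ?_
    rw [← ENNReal.rpow_inv_le_iff hp, ← one_div]
    have h1 := eLpNorm'_le_eLpNorm'_mul_rpow_measure_univ (μ := m.restrict S) hp hpp'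
      hg.aestronglyMeasurable
    simp only [eLpNorm', enorm_eq_self, Measure.restrict_apply_univ] at h1
    refine h1.trans ?_
    gcongr
    exact (setLIntegral_le_lintegral _ _).trans hgint.le
  have hlim : Tendsto (fun c : ℝ≥0∞ => (c ^ (1 / p') * m S ^ (1 / p - 1 / p')) ^ p) (𝓝[>] 0)
      (𝓝 0) := by
    have h1 : Tendsto (fun c : ℝ≥0∞ => c ^ (1 / p')) (𝓝[>] 0) (𝓝 0) := by
      have := (ENNReal.continuous_rpow_const (y := 1 / p')).tendsto 0
      rw [ENNReal.zero_rpow_of_pos (by positivity)] at this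
      exact this.mono_left nhdsWithin_le_nhds
    have h2 := ENNReal.Tendsto.mul_const (b := m S ^ (1 / p - 1 / p')) h1
      (Or.inr (ENNReal.rpow_ne_top_of_nonneg hexp hSt))
    rw [zero_mul] at h2
    have h3 := ((ENNReal.continuous_rpow_const (y := p)).tendsto 0).comp h2
    rwa [ENNReal.zero_rpow_of_pos hp] at h3
  exact le_antisymm (ge_of_tendsto hlim (by
    filter_upwards [self_mem_nhdsWithin] with c hc using key c hc)) zero_le

end BoundedFamilies

/-! ### Logarithmic test functions -/

section LogRamp

theorem Real.abs_log_sub_log_le {m u v : ℝ} (hm : 0 < m) (hu : m ≤ u) (hv : m ≤ v) :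
    |Real.log u - Real.log v| ≤ |u - v| / m := by
  wlog h : v ≤ u generalizing u v
  · rw [abs_sub_comm, abs_sub_comm u]
    exact this hv hu (le_of_not_ge h)
  have hv0 : 0 < v := hm.trans_le hv
  have hu0 : 0 < u := hm.trans_le hu
  rw [abs_of_nonneg (sub_nonneg.2 (Real.log_le_log hv0 h)), abs_of_nonneg (sub_nonneg.2 h),
    ← Real.log_div hu0.ne' hv0.ne']
  calc Real.log (u / v) ≤ u / v - 1 := Real.log_le_sub_one_of_pos (div_pos hu0 hv0)
    _ = (u - v) / v := by rw [sub_div, div_self hv0.ne']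
    _ ≤ _ := div_le_div_of_nonneg_left (sub_nonneg.2 h) hm hv

/-- The continuous function that increases logarithmically from `q + ε` to `q + δ`, where
`δ / ε = e ^ L`, by the amount `1`, and is constant elsewhere. -/
def logRamp (q ε δ L t : ℝ) : ℝ := Real.log (max ε (min δ (t - q))) / L

variable {q ε δ L : ℝ}

theorem abs_clamp_sub_le (s t : ℝ) :
    |max ε (min δ (s - q)) - max ε (min δ (t - q))| ≤ |s - t| := by
  refine (abs_max_sub_max_le_max _ _ _ _).trans (max_le (by simp) ?_)
  refine (abs_min_sub_min_le_max _ _ _ _).trans (max_le (by simp) ?_)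
  simp

theorem abs_logRamp_sub_le (hL : 0 < L) {m s t : ℝ} (hm : 0 < m) (hs : m ≤ max ε (min δ (s - q)))
    (ht : m ≤ max ε (min δ (t - q))) :
    |logRamp q ε δ L s - logRamp q ε δ L t| ≤ |s - t| / m / L := by
  rw [logRamp, logRamp, ← sub_div, abs_div, abs_of_pos hL]
  refine div_le_div_of_nonneg_right ((Real.abs_log_sub_log_le hm hs ht).trans ?_) hL.le
  exact div_le_div_of_nonneg_right (abs_clamp_sub_le s t) hm.le

theorem lipschitzWith_logRamp (hε : 0 < ε) (hL : 0 < L) :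
    LipschitzWith (ε⁻¹ / L).toNNReal (logRamp q ε δ L) := by
  refine LipschitzWith.of_dist_le_mul fun s t => ?_
  rw [Real.dist_eq, Real.dist_eq, Real.coe_toNNReal _ (by positivity)]
  refine (abs_logRamp_sub_le hL hε (le_max_left _ _) (le_max_left _ _)).trans (le_of_eq ?_)
  field_simp

/-- A majorant of the slope of `logRamp`. -/
def logRampSlope (q ε δ L : ℝ) : ℝ → ℝ≥0∞ :=
  (Icc (q + ε) (q + δ)).indicator fun t =>
    2 * (ENNReal.ofReal L)⁻¹ * (ENNReal.ofReal (t - q))⁻¹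

theorem measurable_logRampSlope : Measurable (logRampSlope q ε δ L) :=
  Measurable.indicator (by fun_prop) measurableSet_Icc

theorem eventually_edist_logRamp_le (hε : 0 < ε) (hεδ : ε ≤ δ) (hL : 0 < L) (t : ℝ) :
    ∀ᶠ s in 𝓝 t, edist (logRamp q ε δ L s) (logRamp q ε δ L t) ≤
      logRampSlope q ε δ L t * edist s t := by
  rcases lt_or_ge t (q + ε) with h | h
  · filter_upwards [Iio_mem_nhds h] with s hs
    have h1 : ∀ r < q + ε, logRamp q ε δ L r = Real.log ε / L := fun r hr => by
      rw [logRamp, max_eq_left ((min_le_right _ _).trans (by linarith))]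
    simp [h1 s hs, h1 t h]
  rcases lt_or_ge (q + δ) t with h' | h'
  · filter_upwards [Ioi_mem_nhds h'] with s hs
    have h1 : ∀ r > q + δ, logRamp q ε δ L r = Real.log δ / L := fun r hr => by
      rw [logRamp, min_eq_left (by linarith), max_eq_right hεδ]
    simp [h1 s hs, h1 t h']
  have ht : 0 < t - q := by linarith
  -- Near `t` the argument of the logarithm is at least `(t - q) / 2`, which costs the factor `2`.
  filter_upwards [Metric.ball_mem_nhds t (half_pos ht)] with s hs
  have hclamp : max ε (min δ (t - q)) = t - q := by
    rw [min_eq_right (by linarith), max_eq_right (by linarith)]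
  rw [Metric.mem_ball, Real.dist_eq] at hs
  have hs' : (t - q) / 2 ≤ max ε (min δ (s - q)) := by
    have h1 := abs_clamp_sub_le (q := q) (ε := ε) (δ := δ) s t
    rw [hclamp] at h1
    have h2 := (abs_le.1 (h1.trans hs.le)).1
    linarith
  have h3 := abs_logRamp_sub_le (q := q) hL (half_pos ht) hs' (by rw [hclamp]; linarith)
  have h4 : 2 * (ENNReal.ofReal L)⁻¹ * (ENNReal.ofReal (t - q))⁻¹ * ENNReal.ofReal |s - t| =
      ENNReal.ofReal (|s - t| / ((t - q) / 2) / L) := by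
    rw [← ENNReal.ofReal_inv_of_pos hL, ← ENNReal.ofReal_inv_of_pos ht, ← ENNReal.ofReal_ofNat 2,
      ← ENNReal.ofReal_mul (by positivity), ← ENNReal.ofReal_mul (by positivity),
      ← ENNReal.ofReal_mul (by positivity)]
    congr 1
    field_simp
  rw [logRampSlope, indicator_of_mem (show t ∈ Icc (q + ε) (q + δ) from ⟨h, h'⟩), edist_dist,
    edist_dist, Real.dist_eq, Real.dist_eq, h4]
  exact ENNReal.ofReal_le_ofReal h3

theorem setLIntegral_inv_sub (hε : 0 < ε) (hεδ : ε ≤ δ) :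
    ∫⁻ t in Icc (q + ε) (q + δ), (ENNReal.ofReal (t - q))⁻¹ =
      ENNReal.ofReal (Real.log (δ / ε)) := by
  have hδ : 0 < δ := hε.trans_le hεδ
  have hle : q + ε ≤ q + δ := by linarith
  have h1 : ∫ t in (q + ε)..(q + δ), (t - q)⁻¹ = Real.log (δ / ε) := by
    rw [intervalIntegral.integral_comp_sub_right (fun t => t⁻¹) q, add_sub_cancel_left,
      add_sub_cancel_left, integral_inv_of_pos hε hδ]
  have hcont : ContinuousOn (fun t : ℝ => (t - q)⁻¹) (Icc (q + ε) (q + δ)) :=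
    ContinuousOn.inv₀ (by fun_prop) fun t ht => by linarith [ht.1]
  rw [← h1, intervalIntegral.integral_of_le hle, ← integral_Icc_eq_integral_Ioc,
    ofReal_integral_eq_lintegral_ofReal (hcont.integrableOn_compact isCompact_Icc)]
  · exact setLIntegral_congr_fun measurableSet_Icc fun t ht =>
      (ENNReal.ofReal_inv_of_pos (by linarith [ht.1])).symm
  · refine (ae_restrict_iff' measurableSet_Icc).2 (Eventually.of_forall fun t ht => ?_)
    exact inv_nonneg.2 (by linarith [ht.1])

end LogRamp

/-! ### Vanishing modulus for `p ≤ 1 + α` -/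

section ZeroModulus

variable {n : ℕ} {α : ℝ}

/-- The curves in the ball `B(0, R)` whose `j`-th coordinate takes a value at most `a` and a value
at least `b`. -/
def crossingCurves (j : Fin n) (a b R : ℝ) : Set (ACCurve (EuclideanSpace ℝ (Fin n))) :=
  {γ | (∃ s ∈ Icc γ.a γ.b, ∃ t ∈ Icc γ.a γ.b, γ.toFun s j ≤ a ∧ b ≤ γ.toFun t j) ∧
    ∀ t ∈ Icc γ.a γ.b, γ.toFun t ∈ Metric.ball 0 R}

theorem singularWeight_le (hα : 0 < α) (x : EuclideanSpace ℝ (Fin n)) (j : Fin n) (i : ℕ)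
    (hx : 0 < x j - denseReal i) :
    (singularWeight n α x : ℝ≥0∞) ≤
      ENNReal.ofReal (x j - denseReal i) ^ α * ((2⁻¹ : ℝ≥0∞) ^ i) ^ (-α) := by
  have hc0 : (2⁻¹ : ℝ≥0∞) ^ i ≠ 0 := pow_ne_zero _ (by simp)
  have hct : (2⁻¹ : ℝ≥0∞) ^ i ≠ ∞ := ENNReal.pow_ne_top (by simp)
  rw [coe_singularWeight hα, ENNReal.rpow_neg, ENNReal.rpow_neg, ← Real.enorm_eq_ofReal hx.le]
  calc (singularSup x ^ α)⁻¹ ≤ ((2⁻¹ ^ i / ‖x j - denseReal i‖ₑ) ^ α)⁻¹ := by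
        rw [ENNReal.inv_le_inv]
        gcongr
        exact le_singularSup x j i
    _ = _ := by
        rw [ENNReal.div_rpow_of_nonneg _ _ hα.le, ENNReal.inv_div, div_eq_mul_inv]
        · exact Or.inl (ENNReal.rpow_ne_top_of_nonneg hα.le enorm_ne_top)
        · left
          simp [ENNReal.rpow_eq_zero_iff, hx.ne']

/-- The logarithmic ramp to the right of a hyperplane `x_j = q_i`, near which `w` is at most a
constant times `|x_j - q_i| ^ α`, is a test function for the `(1 + α)`-modulus. -/
theorem pModulus_crossingCurves_le (hα : 0 < α) (j : Fin n) {a b R : ℝ} {i : ℕ}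
    (ha : a < denseReal i) (hb : denseReal i < b) {L : ℝ} (hL : 0 < L) :
    pModulus (singularMeasure n α) (1 + α) (crossingCurves j a b R) ≤
      ENNReal.ofReal (2 * R) ^ (n - 1) * (((2⁻¹ : ℝ≥0∞) ^ i) ^ (-α) * 2 ^ (1 + α)) *
        ENNReal.ofReal L ^ (-α) := by
  have hp : 0 < 1 + α := by linarith
  set q := denseReal i with hq
  set δ := b - q with hδ
  have hδ0 : 0 < δ := sub_pos.2 hb
  set ε := δ * Real.exp (-L) with hε
  have hε0 : 0 < ε := by positivity
  have hεδ : ε ≤ δ := mul_le_of_le_one_right hδ0.le (Real.exp_le_one_iff.2 (by linarith))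
  have hlog : Real.log (δ / ε) = L := by
    rw [hε, ← div_div, div_self hδ0.ne', one_div, ← Real.exp_neg, neg_neg, Real.log_exp]
  set g : EuclideanSpace ℝ (Fin n) → ℝ≥0∞ := fun x => logRampSlope q ε δ L (x j) with hg
  have hgm : Measurable g :=
    measurable_logRampSlope.comp (PiLp.continuous_apply 2 _ j).measurable
  have hcoord : LipschitzWith 1 fun x : EuclideanSpace ℝ (Fin n) => x j :=
    LipschitzWith.of_edist_le fun x y => by
      rw [edist_eq_enorm_sub, edist_eq_enorm_sub, ← PiLp.sub_apply]
      exact PiLp.enorm_apply_le _ _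
  have hF := (lipschitzWith_logRamp (q := q) (δ := δ) hε0 hL).comp hcoord
  have hslope : ∀ x, localSlope (logRamp q ε δ L ∘ fun x : EuclideanSpace ℝ (Fin n) => x j) x
      ≤ g x := by
    intro x
    refine localSlope_le_of_eventually ?_
    filter_upwards [(PiLp.continuous_apply 2 (fun _ : Fin n => ℝ) j).continuousAt.eventually
      (eventually_edist_logRamp_le (q := q) hε0 hεδ hL (x j))] with y hy
    refine hy.trans ?_
    refine mul_le_mul_right ?_ _
    simpa using hcoord y x
  refine (pModulus_le_setLIntegral hp (measurableSet_ball (x := 0) (ε := R))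
    (fun γ hγ => hγ.2) hgm ?_).trans ?_
  · rintro γ ⟨⟨s, hs, t, ht, hsa, htb⟩, -⟩
    have h1 := γ.edist_le_lineIntegral_localSlope hF hs ht
    have h2 : edist (logRamp q ε δ L (γ.toFun s j)) (logRamp q ε δ L (γ.toFun t j)) = 1 := by
      have e1 : logRamp q ε δ L (γ.toFun s j) = Real.log ε / L := by
        rw [logRamp, max_eq_left ((min_le_right _ _).trans (by linarith))]
      have e2 : logRamp q ε δ L (γ.toFun t j) = Real.log δ / L := by
        rw [logRamp, min_eq_left (by linarith), max_eq_right hεδ]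
      rw [e1, e2, edist_comm, edist_dist, Real.dist_eq, ← sub_div,
        ← Real.log_div hδ0.ne' hε0.ne', hlog, div_self hL.ne']
      simp
    calc (1 : ℝ≥0∞) = _ := h2.symm
      _ ≤ _ := h1
      _ ≤ γ.lineIntegral g := lintegral_mono fun r => mul_le_mul_left (hslope _) _
  · have hL0 : ENNReal.ofReal L ≠ 0 := by simpa using hL
    rw [setLIntegral_singularMeasure measurableSet_ball (hgm.pow_const _)]
    set κ := ((2⁻¹ : ℝ≥0∞) ^ i) ^ (-α) * 2 ^ (1 + α) * ENNReal.ofReal L ^ (-(1 + α)) with hκ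
    set φ : ℝ → ℝ≥0∞ := (Icc (q + ε) (q + δ)).indicator fun t =>
      κ * (ENNReal.ofReal (t - q))⁻¹ with hφ
    have hφm : Measurable φ := Measurable.indicator (by fun_prop) measurableSet_Icc
    have hpt : ∀ x : EuclideanSpace ℝ (Fin n), singularWeight n α x * g x ^ (1 + α) ≤ φ (x j) := by
      intro x
      by_cases hx : x j ∈ Icc (q + ε) (q + δ)
      swap
      · simp only [hg, hφ, logRampSlope, indicator_of_notMem hx, ENNReal.zero_rpow_of_pos hp]
        simp
      have hx0 : 0 < x j - q := by linarith [hx.1]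
      simp only [hg, hφ, logRampSlope, indicator_of_mem hx]
      set V := ENNReal.ofReal (x j - q) with hV
      have hV0 : V ≠ 0 := by simpa [hV] using hx0
      have hVt : V ≠ ∞ := ENNReal.ofReal_ne_top
      calc (singularWeight n α x : ℝ≥0∞) * (2 * (ENNReal.ofReal L)⁻¹ * V⁻¹) ^ (1 + α)
          ≤ (V ^ α * ((2⁻¹ : ℝ≥0∞) ^ i) ^ (-α)) *
              (2 * (ENNReal.ofReal L)⁻¹ * V⁻¹) ^ (1 + α) := by
            gcongr
            exact singularWeight_le hα x j i hx0
        _ = κ * (V ^ α * V ^ (-(1 + α))) := by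
            rw [ENNReal.mul_rpow_of_nonneg _ _ hp.le, ENNReal.mul_rpow_of_nonneg _ _ hp.le,
              ENNReal.inv_rpow, ENNReal.inv_rpow, ← ENNReal.rpow_neg V, ← ENNReal.rpow_neg, hκ]
            ring
        _ = κ * V⁻¹ := by
            rw [← ENNReal.rpow_add _ _ hV0 hVt, show α + -(1 + α) = -1 by ring,
              ENNReal.rpow_neg_one]
    calc ∫⁻ x in Metric.ball 0 R, singularWeight n α x * g x ^ (1 + α)
        ≤ ∫⁻ x in Metric.ball (0 : EuclideanSpace ℝ (Fin n)) R, φ (x j) :=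
          lintegral_mono fun x => hpt x
      _ ≤ ENNReal.ofReal (2 * R) ^ (n - 1) * ∫⁻ t, φ t :=
          (EuclideanSpace.setLIntegral_ball_comp_coord_le j hφm 0 R).trans
            (mul_le_mul_right (setLIntegral_le_lintegral _ _) _)
      _ = ENNReal.ofReal (2 * R) ^ (n - 1) * (κ * ENNReal.ofReal L) := by
          rw [hφ, lintegral_indicator measurableSet_Icc, lintegral_const_mul _ (by fun_prop),
            setLIntegral_inv_sub hε0 hεδ, hlog]
      _ = _ := by
          have hLα : ENNReal.ofReal L ^ (-(1 + α)) * ENNReal.ofReal L =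
              ENNReal.ofReal L ^ (-α) := by
            rw [show -(1 + α) = -α - 1 by ring,
              ENNReal.rpow_sub_one_mul_self hL0 ENNReal.ofReal_ne_top]
          rw [hκ, mul_assoc (_ * _ : ℝ≥0∞) (ENNReal.ofReal L ^ _), hLα, ← mul_assoc]

theorem pModulus_crossingCurves_eq_zero (hα : 0 < α) {p : ℝ} (hp1 : 1 ≤ p) (hp : p ≤ 1 + α)
    (j : Fin n) {a b : ℝ} (hab : a < b) (R : ℝ) :
    pModulus (singularMeasure n α) p (crossingCurves j a b R) = 0 := by
  refine pModulus_eq_zero_of_le (by linarith) hp (measurableSet_ball (x := 0) (ε := R))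
    (singularMeasure_ball_lt_top hα _ _).ne (fun γ hγ => hγ.2) ?_
  obtain ⟨i, ha, hb⟩ : ∃ i, denseReal i ∈ Ioo a b :=
    (TopologicalSpace.denseRange_denseSeq ℝ).exists_mem_open isOpen_Ioo (nonempty_Ioo.2 hab)
  set M := ENNReal.ofReal (2 * R) ^ (n - 1) * (((2⁻¹ : ℝ≥0∞) ^ i) ^ (-α) * 2 ^ (1 + α)) with hM
  have hMt : M ≠ ∞ := by
    refine ENNReal.mul_ne_top (ENNReal.pow_ne_top ENNReal.ofReal_ne_top) (ENNReal.mul_ne_top ?_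
      (ENNReal.rpow_ne_top_of_nonneg (by linarith) (by simp)))
    rw [ENNReal.rpow_neg]
    exact ENNReal.inv_ne_top.2 (by simp [ENNReal.rpow_eq_zero_iff])
  have hlim : Tendsto (fun L : ℝ => M * ENNReal.ofReal L ^ (-α)) atTop (𝓝 0) := by
    have h1 := ((ENNReal.continuous_rpow_const (y := -α)).tendsto ∞).comp
      ENNReal.tendsto_ofReal_atTop
    rw [ENNReal.top_rpow_of_neg (by linarith)] at h1
    simpa using ENNReal.Tendsto.const_mul h1 (Or.inr hMt)
  exact le_antisymm (ge_of_tendsto hlim (by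
    filter_upwards [eventually_gt_atTop 0] with L hL using
      pModulus_crossingCurves_le hα j ha hb hL)) zero_le

/-- A non-constant curve is bounded and has a coordinate that crosses an interval with rational
endpoints, so that countably many families of crossing curves contain all non-constant ones. -/
theorem pModulus_nonConstant_eq_zero (n : ℕ) (hα : 0 < α) {p : ℝ} (hp1 : 1 ≤ p) (hp : p ≤ 1 + α) :
    pModulus (singularMeasure n α) p {γ | γ.NonConstant} = 0 := by
  have hU : pModulus (singularMeasure n α) p
      (⋃ z : Fin n × {ab : ℚ × ℚ // (ab.1 : ℝ) < ab.2} × ℕ,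
        crossingCurves z.1 z.2.1.1.1 z.2.1.1.2 z.2.2) = 0 :=
    pModulus_iUnion_eq_zero (by linarith) fun z =>
      pModulus_crossingCurves_eq_zero hα hp1 hp _ z.2.1.2 _
  refine le_antisymm ((pModulus_mono ?_).trans hU.le) zero_le
  rintro γ ⟨s, hs, t, ht, hne⟩
  obtain ⟨j, hj⟩ : ∃ j, γ.toFun s j ≠ γ.toFun t j := by
    by_contra hcon
    push Not at hcon
    exact hne (PiLp.ext hcon)
  wlog hlt : γ.toFun s j < γ.toFun t j generalizing s t
  · exact this t ht s hs hne.symm hj.symm (lt_of_le_of_ne (not_lt.1 hlt) hj.symm)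
  obtain ⟨a, ha, ha'⟩ := exists_rat_btwn hlt
  obtain ⟨b, hb, hb'⟩ := exists_rat_btwn ha'
  obtain ⟨M, hM⟩ := γ.exists_forall_dist_le
  obtain ⟨k, hk⟩ := exists_nat_gt (‖γ.toFun γ.a‖ + M)
  refine mem_iUnion.2 ⟨(j, ⟨(a, b), hb⟩, k), ⟨s, hs, t, ht, ha.le, hb'.le⟩, fun r hr => ?_⟩
  rw [mem_ball_zero_iff]
  have h1 := hM r hr
  rw [dist_comm, dist_eq_norm] at h1
  have h2 := norm_le_norm_add_norm_sub' (γ.toFun r) (γ.toFun γ.a)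
  dsimp only
  linarith

/-- If almost no curve is non-constant, then `0` is an upper gradient of every function. -/
theorem isPWeakGradient_zero {X : Type*} [MetricSpace X] [MeasurableSpace X] {m : Measure X}
    {p : ℝ} (hp : 0 < p) (h : pModulus m p {γ : ACCurve X | γ.NonConstant} = 0) (f : X → ℝ) :
    IsPWeakGradient m p f fun _ => 0 := by
  refine ⟨⟨measurable_const, le_antisymm ((pModulus_mono fun γ hγ => ?_).trans h.le) zero_le⟩,
    fun x => ⟨univ, univ_mem, by simp [hp]⟩, fun _ _ _ => Eventually.of_forall fun _ => zero_le⟩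
  refine ⟨γ.b, right_mem_Icc.2 γ.a_le_b, γ.a, left_mem_Icc.2 γ.a_le_b, fun heq => hγ ?_⟩
  simp [heq]

end ZeroModulus

end
theorem theorem1 (n : ℕ) (α : ℝ) (hα : 0 < α) :
    ∃ w : EuclideanSpace ℝ (Fin n) → ℝ≥0, Measurable w ∧
      ∃ μ : Measure (EuclideanSpace ℝ (Fin n)),
        μ = volume.withDensity (fun x => (w x : ℝ≥0∞)) ∧
        IsDoublingMeasure μ ∧
        (∀ p : ℝ, 1 ≤ p → p ≤ 1 + α →
          pModulus μ p {γ | γ.NonConstant} = 0 ∧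
          ∀ f : EuclideanSpace ℝ (Fin n) → ℝ, IsPWeakGradient μ p f (fun _ => 0)) ∧
        (∀ p : ℝ, 1 + α < p →
          IsMuckenhouptWeight p w ∧
          WeakPoincare μ p ∧
          ∀ f : EuclideanSpace ℝ (Fin n) → ℝ, (∃ K : ℝ≥0, LipschitzWith K f) →
            IsPWeakGradient μ p f (localSlope f)) := by
  refine ⟨singularWeight n α, measurable_singularWeight, singularMeasure n α, rfl,
    isDoublingMeasure_singularMeasure n hα, fun p hp1 hp => ?_, fun p hp => ?_⟩
  · have h := pModulus_nonConstant_eq_zero n hα hp1 hp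
    exact ⟨h, isPWeakGradient_zero (by linarith) h⟩
  · exact ⟨isMuckenhouptWeight_singularWeight n hα hp, weakPoincare_singularMeasure n hα hp,
      fun f ⟨_, hf⟩ => isPWeakGradient_localSlope hα hp hf⟩
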